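/- Let $n,k\ge 0$ and work in the field $\mathbb R(x_1,\dots,x_n,q,t)$ of rational functions. For $i\ge1$ let $\Psi_i$ act on this field as the $\mathbb R$-linear field endomorphism that sends each of $x_1,\dots,x_n,q,t$ to its $i$-th power. The ring of symmetric functions over $\mathbb R$ is freely generated by the power sums $\Psi_1,\Psi_2,\dots$; for a symmetric function $f$ and a rational function $F$ let $f[F]$ be the value obtained from $f$ by replacing each power sum $\Psi_i$ by $\Psi_i[F]$. Let $S_m$ be the complete symmetric function of degree $m$ ($S_m=0$ for $m<0$), let $S_\lambda=\det\bigl(S_{\lambda_i+j-i}\bigr)_{1\le i,j\le \ell(\lambda)}$ be the Schur function of a partition $\lambda$, where $\ell(\lambda)$ is the number of nonzero parts of $\lambda$ and $\lambda_i=0$ for $i>\ell(\lambda)$, and put $$X=x_1+\cdots+x_n,\qquad X^{tq}=X\,\frac{t-1}{q-1}.$$ For $I\subseteq\{1,\dots,n\}$ and $0\le l\le |I|$ let $$M^{(I)}_l=t^{\binom l2}\sum_{J\subseteq I,\ |J|=l}\ \Bigl(\prod_{i\in J,\ j\in I\setminus J}\frac{t x_i-x_j}{x_i-x_j}\Bigr)\,\prod_{j\in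 J}\Theta_j ,$$ where $\Theta_j$ is the substitution $x_j\mapsto q x_j$, and define the creation operator $$B_k^{(n)}=\sum_{I\subseteq\{1,\dots,n\},\ |I|=k}\ \sum_{l=0}^k(-t)^l\Bigl(\prod_{i\in I}x_i\Bigr)\Bigl(\prod_{i\in I,\ j\notin I}\frac{x_i-x_j/t}{x_i-x_j}\Bigr)M^{(I)}_l .$$ Then, for every partition $\lambda$ with $\ell(\lambda)\le k$, setting $f(i,j)=\lambda_i+j-i+1$, $$B_k^{(n)}\,S_\lambda[X^{tq}]=\det\Bigl[\bigl(1-q^{f(i,j)}\,t^{\,k-j}\bigr)\,S_{f(i,j)}[X^{tq}]\Bigr]_{1\le i,j\le k}.$$ -/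

import Mathlib

open scoped BigOperators

noncomputable section

namespace Creation

/-! ### The ring of symmetric functions, on the power sums as free generators -/

/-- The ring of symmetric functions (with real coefficients), freely generated as a commutative
algebra by the power sums `Ψ₁, Ψ₂, Ψ₃, …`. -/
abbrev SymFun : Type := MvPolynomial ℕ+ ℝ

/-- The power sum `Ψ_i`, `i ≥ 1`. -/
def powerSum (i : ℕ+) : SymFun := MvPolynomial.X i

/-- The complete symmetric function `S_m`, `m ∈ ℕ`, written in the power sums:
`S_0 = 1` and `m S_m = Ψ_1 S_{m-1} + Ψ_2 S_{m-2} + ⋯ + Ψ_m S_0`.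
See `specialize_complete`. -/
def complete : ℕ → SymFun
  | 0 => 1
  | m + 1 =>
      MvPolynomial.C (((m : ℝ) + 1)⁻¹) *
        ∑ i : Fin (m + 1), powerSum (i : ℕ).succPNat * complete (m - i)
  decreasing_by exact Nat.lt_succ_of_le (Nat.sub_le _ _)

/-- The complete symmetric function `S_m` for `m ∈ ℤ`, with `S_m = 0` for `m < 0`. -/
def completeZ : ℤ → SymFun
  | Int.ofNat m => complete m
  | Int.negSucc _ => 0

/-- The number of (nonzero) parts `ℓ(λ)` of a partition. Partitions are Young diagrams, whose
row lengths are `λ_1 = lam.rowLen 0 ≥ λ_2 = lam.rowLen 1 ≥ ⋯`, equal to `0` from `ℓ(λ)` on. -/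
def numParts (lam : YoungDiagram) : ℕ := lam.colLen 0

/-- The Schur function `S_λ = det (S_{λ_i + j - i})`, the determinant having size `ℓ(λ)`. -/
def schur (lam : YoungDiagram) : SymFun :=
  Matrix.det (Matrix.of fun i j : Fin (numParts lam) =>
    completeZ ((lam.rowLen i : ℤ) + (j : ℤ) - (i : ℤ)))

section Complete

open MvPolynomial

/-- Newton's formula for the complete homogeneous symmetric polynomials of finitely many
variables. -/
theorem newton_hsymm (σ : Type) [Fintype σ] [DecidableEq σ] (m : ℕ) :
    ((m : MvPolynomial σ ℝ) + 1) * hsymm σ ℝ (m + 1) =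
      ∑ i ∈ Finset.range (m + 1), psum σ ℝ (i + 1) * hsymm σ ℝ (m - i) := by
  classical
  have key : ∀ i ∈ Finset.range (m + 1), ∀ a : σ,
      (X a : MvPolynomial σ ℝ) ^ (i + 1) * hsymm σ ℝ (m - i) =
        ∑ s : Sym σ (m + 1), if i + 1 ≤ s.1.count a then (s.1.map X).prod else 0 := by
    intro i hi a
    have hi' : i ≤ m := Nat.lt_succ_iff.mp (Finset.mem_range.mp hi)
    rw [← Finset.sum_filter, hsymm, Finset.mul_sum]
    refine Finset.sum_bij'
      (fun s _ => ⟨Multiset.replicate (i + 1) a + s.1, by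
        rw [Multiset.card_add, Multiset.card_replicate, s.2]; omega⟩)
      (fun s hs => ⟨s.1 - Multiset.replicate (i + 1) a, by
        have h := (Finset.mem_filter.mp hs).2
        rw [Multiset.card_sub (Multiset.le_count_iff_replicate_le.mp h), s.2,
          Multiset.card_replicate]; omega⟩) ?_ ?_ ?_ ?_ ?_
    · intro s _
      refine Finset.mem_filter.mpr ⟨Finset.mem_univ _, ?_⟩
      change i + 1 ≤ Multiset.count a (Multiset.replicate (i + 1) a + s.1)
      rw [Multiset.count_add, Multiset.count_replicate_self]
      exact Nat.le_add_right _ _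
    · intro s _
      exact Finset.mem_univ _
    · intro s _
      apply Subtype.ext
      exact add_tsub_cancel_left _ _
    · intro s hs
      have h := (Finset.mem_filter.mp hs).2
      apply Subtype.ext
      exact add_tsub_cancel_of_le (Multiset.le_count_iff_replicate_le.mp h)
    · intro s _
      change _ = ((Multiset.replicate (i + 1) a + s.1).map X).prod
      rw [Multiset.map_add, Multiset.map_replicate, Multiset.prod_add, Multiset.prod_replicate]
  have hcount : ∀ s : Sym σ (m + 1),
      (∑ a : σ, ∑ i ∈ Finset.range (m + 1),
        if i + 1 ≤ s.1.count a then (s.1.map (X : σ → MvPolynomial σ ℝ)).prod else 0) =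
      ((m : MvPolynomial σ ℝ) + 1) * (s.1.map X).prod := by
    intro s
    have h1 : ∀ a : σ, (∑ i ∈ Finset.range (m + 1),
        if i + 1 ≤ s.1.count a then (s.1.map (X : σ → MvPolynomial σ ℝ)).prod else 0) =
        (s.1.count a : MvPolynomial σ ℝ) * (s.1.map X).prod := by
      intro a
      have hle : s.1.count a ≤ m + 1 :=
        (Multiset.count_le_card a s.1).trans s.2.le
      rw [← Finset.sum_filter, Finset.sum_const, nsmul_eq_mul]
      congr 2
      have : (Finset.range (m + 1)).filter (fun i => i + 1 ≤ s.1.count a) =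
          Finset.range (s.1.count a) := by
        ext i; simp only [Finset.mem_filter, Finset.mem_range]; omega
      rw [this, Finset.card_range]
    rw [Finset.sum_congr rfl fun a _ => h1 a, ← Finset.sum_mul, ← Nat.cast_sum,
      Multiset.sum_count_eq_card (fun a _ => Finset.mem_univ a), s.2]
    push_cast
    rfl
  calc ((m : MvPolynomial σ ℝ) + 1) * hsymm σ ℝ (m + 1)
      = ∑ s : Sym σ (m + 1), ∑ a : σ, ∑ i ∈ Finset.range (m + 1),
          (if i + 1 ≤ s.1.count a then (s.1.map X).prod else 0) := by
        rw [hsymm, Finset.mul_sum]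
        exact Finset.sum_congr rfl fun s _ => (hcount s).symm
    _ = ∑ i ∈ Finset.range (m + 1), ∑ a : σ, ∑ s : Sym σ (m + 1),
          (if i + 1 ≤ s.1.count a then (s.1.map X).prod else 0) := by
        rw [Finset.sum_comm' (t' := Finset.univ) (s' := fun _ => Finset.univ) (by simp)]
        rw [Finset.sum_congr rfl fun a _ => Finset.sum_comm]
        rw [Finset.sum_comm]
    _ = _ := by
        refine Finset.sum_congr rfl fun i hi => ?_
        rw [psum, Finset.sum_mul]
        exact Finset.sum_congr rfl fun a _ => (key i hi a).symm

/-- Replacing each `Ψ_i` by the power sum polynomial `∑ x^i` of a finite alphabet, `S_m` becomes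
the complete homogeneous symmetric polynomial of degree `m` (the sum of all monomials of
degree `m`) of this alphabet. -/
theorem specialize_complete (σ : Type) [Fintype σ] [DecidableEq σ] (m : ℕ) :
    aeval (fun i : ℕ+ => psum σ ℝ i) (complete m) = hsymm σ ℝ m := by
  classical
  induction m using Nat.strong_induction_on with
  | _ m ih =>
    cases m with
    | zero => simp [complete]
    | succ m =>
      have hN := newton_hsymm σ m
      rw [complete, map_mul, map_sum]
      have h1 : ∑ i : Fin (m + 1),
          aeval (fun i : ℕ+ => psum σ ℝ i) (powerSum (i : ℕ).succPNat * complete (m - i)) =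
          ∑ i ∈ Finset.range (m + 1), psum σ ℝ (i + 1) * hsymm σ ℝ (m - i) := by
        rw [Finset.sum_range]
        refine Finset.sum_congr rfl fun i _ => ?_
        rw [map_mul, ih (m - i) (by omega), powerSum, aeval_X, Nat.succPNat_coe]
      rw [h1, ← hN, ← mul_assoc, aeval_C, algebraMap_eq]
      have h2 : (C (((m : ℝ) + 1)⁻¹) : MvPolynomial σ ℝ) * ((m : MvPolynomial σ ℝ) + 1) = 1 := by
        have : ((m : MvPolynomial σ ℝ) + 1) = C ((m : ℝ) + 1) := by simp
        rw [this, ← C_mul, inv_mul_cancel₀ (by positivity), C_1]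
      rw [h2, one_mul]

end Complete

/-! ### Rational functions in `x_1, …, x_n, q, t`, and the action of symmetric functions -/

/-- The indeterminates `x_1, …, x_n, q, t`. -/
inductive Var (n : ℕ) : Type
  | x (i : Fin n) : Var n
  | q : Var n
  | t : Var n

/-- The field `ℝ(x_1, …, x_n, q, t)` of rational functions. -/
abbrev RatFun (n : ℕ) : Type := FractionRing (MvPolynomial (Var n) ℝ)

/-- An indeterminate as a rational function. -/
def var {n : ℕ} (v : Var n) : RatFun n := algebraMap (MvPolynomial (Var n) ℝ) _ (MvPolynomial.X v)

/-- The rational function `x_i`. -/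
abbrev xv {n : ℕ} (i : Fin n) : RatFun n := var (Var.x i)

/-- The rational function `q`. -/
abbrev qv (n : ℕ) : RatFun n := var Var.q

/-- The rational function `t`. -/
abbrev tv (n : ℕ) : RatFun n := var Var.t

theorem adams_injective (n : ℕ) (i : ℕ+) : Function.Injective
    ((algebraMap (MvPolynomial (Var n) ℝ) (RatFun n)).comp
      (MvPolynomial.expand (i : ℕ) : _ →ₐ[ℝ] MvPolynomial (Var n) ℝ).toRingHom) :=
  (IsFractionRing.injective (MvPolynomial (Var n) ℝ) (RatFun n)).comp
    (MvPolynomial.expand_injective i.pos)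

/-- The action of `Ψ_i` on rational functions: it raises every monomial in
`x_1, …, x_n, q, t`, in numerator and denominator, to the `i`-th power and fixes the real
coefficients; that is, the field endomorphism sending each indeterminate to its `i`-th power. -/
def adams (n : ℕ) (i : ℕ+) : RatFun n →+* RatFun n :=
  IsFractionRing.lift (adams_injective n i)

/-- The action `f[F]` of a symmetric function `f` on a rational function `F`: the value of `f`
when each power sum `Ψ_i` is replaced by `Ψ_i[F]`. -/
def pleth {n : ℕ} (f : SymFun) (F : RatFun n) : RatFun n :=
  MvPolynomial.aeval (fun i : ℕ+ => adams n i F) f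

/-- The alphabet `X = x_1 + ⋯ + x_n`. -/
def alphabet (n : ℕ) : RatFun n := ∑ i : Fin n, xv i

/-- `X^{tq} = X (t - 1) / (q - 1)`. -/
def alphabetTQ (n : ℕ) : RatFun n := alphabet n * (tv n - 1) / (qv n - 1)

/-! ### The `q`-shifts, the Macdonald operators and the creation operators -/

/-- The values of the indeterminates under `x_i ↦ q x_i` for `i ∈ J`. -/
def shiftVar {n : ℕ} (J : Finset (Fin n)) : Var n → MvPolynomial (Var n) ℝ
  | Var.x i => if i ∈ J then MvPolynomial.X Var.q * MvPolynomial.X (Var.x i)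
      else MvPolynomial.X (Var.x i)
  | Var.q => MvPolynomial.X Var.q
  | Var.t => MvPolynomial.X Var.t

/-- The inverse substitution, used only to see that the shift is injective. -/
def unshiftVar {n : ℕ} (J : Finset (Fin n)) : Var n → RatFun n
  | Var.x i => if i ∈ J then (qv n)⁻¹ * xv i else xv i
  | Var.q => qv n
  | Var.t => tv n

theorem unshift_shift {n : ℕ} (J : Finset (Fin n)) (p : MvPolynomial (Var n) ℝ) :
    MvPolynomial.aeval (unshiftVar J) (MvPolynomial.aeval (shiftVar J) p) =
      algebraMap (MvPolynomial (Var n) ℝ) (RatFun n) p := by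
  have : (MvPolynomial.aeval (unshiftVar J)).comp (MvPolynomial.aeval (shiftVar J)) =
      IsScalarTower.toAlgHom ℝ (MvPolynomial (Var n) ℝ) (RatFun n) := by
    apply MvPolynomial.algHom_ext
    intro v
    cases v with
    | x i =>
      by_cases h : i ∈ J
      · simp [shiftVar, unshiftVar, h, var]
      · simp [shiftVar, unshiftVar, h, var]
    | q => simp [shiftVar, unshiftVar, var]
    | t => simp [shiftVar, unshiftVar, var]
  exact DFunLike.congr_fun this p

theorem shift_injective {n : ℕ} (J : Finset (Fin n)) : Function.Injective
    ((algebraMap (MvPolynomial (Var n) ℝ) (RatFun n)).comp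
      (MvPolynomial.aeval (shiftVar J) : _ →ₐ[ℝ] MvPolynomial (Var n) ℝ).toRingHom) := by
  refine (IsFractionRing.injective (MvPolynomial (Var n) ℝ) (RatFun n)).comp ?_
  intro a b hab
  apply IsFractionRing.injective (MvPolynomial (Var n) ℝ) (RatFun n)
  rw [← unshift_shift J a, ← unshift_shift J b]
  exact congrArg _ hab

/-- The product `Θ_J = ∏_{j ∈ J} Θ_j` of the `q`-shift operators `Θ_j : x_j ↦ q x_j`, as the
field endomorphism that replaces `x_j` by `q x_j` for every `j ∈ J` and fixes the other
indeterminates. The single operator `Θ_j` is `shift {j}`. -/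
def shift {n : ℕ} (J : Finset (Fin n)) : RatFun n →+* RatFun n :=
  IsFractionRing.lift (shift_injective J)

theorem shift_var {n : ℕ} (J : Finset (Fin n)) (v : Var n) :
    shift J (var v) = algebraMap (MvPolynomial (Var n) ℝ) (RatFun n) (shiftVar J v) := by
  rw [shift, var, IsFractionRing.lift_algebraMap]
  simp

/-- `Θ_∅` is the identity. -/
theorem shift_empty (n : ℕ) : shift (∅ : Finset (Fin n)) = RingHom.id (RatFun n) := by
  apply IsFractionRing.ringHom_ext (A := MvPolynomial (Var n) ℝ)
  intro p
  rw [shift, IsFractionRing.lift_algebraMap]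
  have : (shiftVar (∅ : Finset (Fin n))) = MvPolynomial.X := by
    funext v
    cases v <;> simp [shiftVar]
  simp [this]

/-- `Θ_J` is the composite of the single shifts `Θ_j`, `j ∈ J`. -/
theorem shift_insert {n : ℕ} (J : Finset (Fin n)) (i : Fin n) (hi : i ∉ J) :
    shift (insert i J) = (shift {i}).comp (shift J) := by
  apply IsFractionRing.ringHom_ext (A := MvPolynomial (Var n) ℝ)
  intro p
  rw [RingHom.comp_apply, shift, shift, shift, IsFractionRing.lift_algebraMap,
    IsFractionRing.lift_algebraMap]
  change algebraMap _ _ (MvPolynomial.aeval (shiftVar (insert i J)) p) =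
    IsFractionRing.lift (shift_injective {i})
      (algebraMap _ _ (MvPolynomial.aeval (shiftVar J) p))
  rw [IsFractionRing.lift_algebraMap]
  change _ = algebraMap _ _ (MvPolynomial.aeval (shiftVar {i})
    (MvPolynomial.aeval (shiftVar J) p))
  congr 1
  rw [← AlgHom.comp_apply]
  congr 1
  apply MvPolynomial.algHom_ext
  intro v
  cases v with
  | x j =>
    by_cases h : j = i
    · subst h; simp [shiftVar, hi]
    · by_cases h' : j ∈ J <;> simp [shiftVar, h, h']
  | q => simp [shiftVar]
  | t => simp [shiftVar]

/-- The resultant `R(A, B) = ∏_{a ∈ A, b ∈ B} (a - b)` of the alphabets `A = {c x_i : i ∈ I}` and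
`B = {d x_j : j ∈ J}`, for scalars `c, d`. -/
def resultant {n : ℕ} (c : RatFun n) (I : Finset (Fin n)) (d : RatFun n) (J : Finset (Fin n)) :
    RatFun n :=
  ∏ i ∈ I, ∏ j ∈ J, (c * xv i - d * xv j)

/-- The Macdonald operator `M_l^{(I)}` in the variables `x_i`, `i ∈ I`:
`t^{l(l-1)/2} ∑_{J ⊆ I, |J| = l} R(t X_J, X_{I∖J}) / R(X_J, X_{I∖J}) Θ_J`. -/
def macdonald {n : ℕ} (l : ℕ) (I : Finset (Fin n)) (f : RatFun n) : RatFun n :=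
  tv n ^ l.choose 2 * ∑ J ∈ I.powersetCard l,
    resultant (tv n) J 1 (I \ J) / resultant 1 J 1 (I \ J) * shift J f

/-- The creation operator
`B_k^{(n)} = ∑_{|I| = k} ∑_{l = 0}^{k} (-t)^l x^I R(X_I, X_I^c / t) / R(X_I, X_I^c) M_l^{(I)}`,
where `I` runs over the `k`-element subsets of `{1, …, n}`. -/
def creation (n k : ℕ) (f : RatFun n) : RatFun n :=
  ∑ I ∈ (Finset.univ : Finset (Fin n)).powersetCard k, ∑ l ∈ Finset.range (k + 1),
    (-tv n) ^ l * (∏ i ∈ I, xv i) * (resultant 1 I (tv n)⁻¹ Iᶜ / resultant 1 I 1 Iᶜ) *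
      macdonald l I f

/-- `f(i, j) = λ_i + (j - i + 1)`. The difference `j - i` does not change when rows and columns
are numbered from `0`, and `λ_i` is then `lam.rowLen i`. -/
def fIdx (lam : YoungDiagram) {k : ℕ} (i j : Fin k) : ℤ :=
  (lam.rowLen i : ℤ) + ((j : ℤ) - (i : ℤ) + 1)

end Creation

end

/-! Expanding the Macdonald operators turns the creation operator into a sum of `c_{I,J} Θ_J` over
`J ⊆ I ⊆ {1, …, n}`, `|I| = k`, with explicit rational coefficients (`creationTerm` at `w = 1`). The
shift `Θ_J` adds `(t - 1) ∑_{j ∈ J} x_j` to the alphabet `X^{tq}`, so it multiplies the generating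
series `∑ S_m[X^{tq}] y^m` by `∏_{j ∈ J} (1 - x_j y) / (1 - t x_j y)`. For `J = {1, …, n}` the new
alphabet is `q X^{tq}`, which explains the factors `q^f` on the right: `q^m S_m[X^{tq}] = S_m[q
X^{tq}]`. After this `q` plays no further role.

Row `a` of each determinant is now a coefficient extraction in its own variable `y_a`. A determinant
is linear in each row, so it suffices to prove an identity in free variables
(`sum_det_linearMap_eq`). With `u_a = 1 / y_a`, `φ(u) = ∏_i (u - x_i) / (u - t x_i)` and columns
numbered from `0`, it says that the Vandermonde determinant of the `u_a`, multiplied by `∑ c_{I,J}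
∏_a ∏_{i ∈ J} (u_a - x_i) / (u_a - t x_i)`, equals `det [u_a^{j+1} (1 - t^{k-1-j} φ(u_a))]`; this is
`creationSum_mul_det_vandermonde`.

That identity is proved by induction on the number of `u`'s, for all finite sets of variables `x_i`.
As functions of one `u`, cleared of denominators, both sides are polynomials of too small a degree
to differ if they agree at `0`, at the other `u`'s and at all `t x_m`. At `0` the left side vanishes
by Macdonald's determinantal formula (`macdonaldSum_neg_one_eq_zero`); at another `u` both sides
vanish; at `t x_m` both sides reduce to the case with `x_m` and one `u` removed. -/

namespace Creation

/-! ### Macdonald operators and their determinantal formula -/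

section Core

open Finset Polynomial

variable {K ι : Type*} [Field K] [DecidableEq ι]

/-- The quotient of resultants `∏_{i ∈ I, j ∈ J} (c x_i - d x_j) / (x_i - x_j)`. -/
def crossRatio (c d : K) (x : ι → K) (I J : Finset ι) : K :=
  ∏ i ∈ I, ∏ j ∈ J, (c * x i - d * x j) / (x i - x j)

/-- The generating sum `∑_l s^l M_l^{(I)}` of the Macdonald operators, applied to a function that
is multiplied by `w_i` under the `q`-shift of `x_i`. -/
def macdonaldSum (t s : K) (x w : ι → K) (I : Finset ι) : K :=
  ∑ J ∈ I.powerset, s ^ #J * t ^ (#J).choose 2 * crossRatio t 1 x J (I \ J) * ∏ i ∈ J, w i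

theorem sum_card_filter_lt {α : Type*} [LinearOrder α] (J : Finset α) :
    ∑ i ∈ J, #{j ∈ J | i < j} = (#J).choose 2 := by
  induction J using Finset.induction_on_max with
  | empty => simp
  | insert m J hm ih =>
    have hmJ : m ∉ J := fun h => lt_irrefl _ (hm m h)
    rw [sum_insert hmJ, card_insert_of_notMem hmJ, Nat.choose_succ_succ' _ 1, Nat.choose_one_right,
      ← ih]
    have h0 : #{j ∈ insert m J | m < j} = 0 := by
      rw [card_eq_zero, filter_eq_empty_iff]
      intro j hj
      rcases mem_insert.mp hj with rfl | hj
      · exact lt_irrefl _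
      · exact (hm j hj).not_gt
    have h1 : ∀ i ∈ J, #{j ∈ insert m J | i < j} = 1 + #{j ∈ J | i < j} := by
      intro i hi
      rw [filter_insert, if_pos (hm i hi), card_insert_of_notMem (by simp [hmJ]), add_comm]
    rw [h0, sum_congr rfl h1, sum_add_distrib]
    simp

/-- The effect on the Vandermonde product of multiplying the variables in `J` by `t`. -/
theorem vandermonde_prod_scale {n : ℕ} (t : K) (x : Fin n → K) (hx : Function.Injective x)
    (J : Finset (Fin n)) :
    ∏ i, ∏ j ∈ Ioi i, ((if j ∈ J then t * x j else x j) - (if i ∈ J then t * x i else x i)) =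
      t ^ (#J).choose 2 * crossRatio t 1 x J (univ \ J) * ∏ i, ∏ j ∈ Ioi i, (x j - x i) := by
  -- A pair split by `J` contributes its cross ratio whichever of its two members lies in `J`, so `B
  -- i j * B j i` serves for the unordered pair.
  set B : Fin n → Fin n → K :=
    fun i j => if i ∈ J ∧ j ∉ J then (t * x i - 1 * x j) / (x i - x j) else 1 with hB
  have hfac : ∀ i, ∀ j ∈ Ioi i,
      ((if j ∈ J then t * x j else x j) - (if i ∈ J then t * x i else x i)) =
        (if i ∈ J ∧ j ∈ J then t else 1) * (B i j * B j i) * (x j - x i) := by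
    intro i j hij
    have h1 : x j - x i ≠ 0 := sub_ne_zero.mpr fun h => (mem_Ioi.mp hij).ne' (hx h)
    have h2 : x i - x j ≠ 0 := sub_ne_zero.mpr fun h => (mem_Ioi.mp hij).ne (hx h)
    by_cases hi : i ∈ J <;> by_cases hj : j ∈ J <;> simp only [hB, hi, hj] <;> simp
    · ring
    · field_simp; ring
    · field_simp
  rw [prod_congr rfl fun i _ => prod_congr rfl (hfac i)]
  simp only [prod_mul_distrib]
  congr 1
  congr 1
  · rw [← sum_card_filter_lt, ← prod_pow_eq_pow_sum, ← prod_filter_mul_prod_filter_not univ (· ∈ J)]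
    have : ∏ i with i ∉ J, ∏ j ∈ Ioi i, (if i ∈ J ∧ j ∈ J then t else 1) = 1 :=
      prod_eq_one fun i hi => prod_eq_one fun j _ => by simp [(mem_filter.mp hi).2]
    rw [this, mul_one, filter_univ_mem]
    refine prod_congr rfl fun i hi => ?_
    simp only [hi, true_and]
    rw [← prod_filter, prod_const]
    congr 2
    ext j
    simp [and_comm]
  · have h := Finset.prod_prod_Ioi_mul_eq_prod_prod_off_diag (fun a b => B b a)
    simp only [prod_mul_distrib] at h
    rw [h, crossRatio, ← prod_filter_mul_prod_filter_not univ (· ∈ J)]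
    have : ∏ i with i ∉ J, ∏ j ∈ {i}ᶜ, B i j = 1 :=
      prod_eq_one fun i hi => prod_eq_one fun j _ => by simp [hB, (mem_filter.mp hi).2]
    rw [this, mul_one, filter_univ_mem]
    refine prod_congr rfl fun i hi => ?_
    rw [← prod_filter_mul_prod_filter_not {i}ᶜ (· ∈ J)]
    have : ∏ j ∈ {i}ᶜ with j ∈ J, B i j = 1 :=
      prod_eq_one fun j hj => by simp [hB, (mem_filter.mp hj).2]
    rw [this, one_mul]
    refine prod_congr ?_ fun j hj => ?_
    · ext j
      simp only [mem_filter, mem_compl, mem_singleton, mem_sdiff, mem_univ, true_and]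
      exact ⟨fun h => h.2, fun h => ⟨fun e => h (e ▸ hi), h⟩⟩
    · simp only [mem_sdiff, mem_univ, true_and] at hj
      simp [hB, hi, hj]

/-- Macdonald's determinantal formula. -/
theorem macdonaldSum_mul_det_vandermonde {n : ℕ} (t s : K) (x w : Fin n → K)
    (hx : Function.Injective x) :
    macdonaldSum t s x w univ * (Matrix.vandermonde x).det =
      (Matrix.of fun i j : Fin n => s * w i * (t * x i) ^ (j : ℕ) + x i ^ (j : ℕ)).det := by
  -- Row multilinearity: `J` is the set of rows where the first summand is chosen. What remains is a
  -- Vandermonde matrix with `x_i` replaced by `t x_i` for `i ∈ J`.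
  have h := (Matrix.detRowAlternating (R := K) (n := Fin n)).toMultilinearMap.map_add_univ
    (fun i j => s * w i * (t * x i) ^ (j : ℕ)) (fun i j => x i ^ (j : ℕ))
  refine Eq.trans ?_ h.symm
  rw [macdonaldSum, sum_mul, powerset_univ]
  refine sum_congr rfl fun J _ => ?_
  have hrow : J.piecewise (fun i (j : Fin n) => s * w i * (t * x i) ^ (j : ℕ))
      (fun i j => x i ^ (j : ℕ)) = Matrix.of fun i j => (if i ∈ J then s * w i else 1) *
        Matrix.vandermonde (fun i => if i ∈ J then t * x i else x i) i j := by
    ext i j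
    by_cases hi : i ∈ J <;> simp [hi, Matrix.vandermonde_apply]
  rw [hrow]
  change _ = Matrix.det _
  rw [Matrix.det_mul_column, Matrix.det_vandermonde, Matrix.det_vandermonde,
    vandermonde_prod_scale t x hx, prod_ite_mem, univ_inter, prod_mul_distrib, prod_const]
  ring

theorem macdonaldSum_map {κ : Type*} [DecidableEq κ] (t s : K) (x w : ι → K) (e : κ ↪ ι)
    (I : Finset κ) :
    macdonaldSum t s x w (I.map e) = macdonaldSum t s (x ∘ e) (w ∘ e) I := by
  have h : (I.map e).powerset = I.powerset.map ⟨Finset.map e, Finset.map_injective e⟩ := by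
    ext A
    simp only [mem_powerset, Finset.mem_map, Function.Embedding.coeFn_mk, subset_map_iff]
    exact ⟨fun ⟨u, hu, h⟩ => ⟨u, hu, h.symm⟩, fun ⟨u, hu, h⟩ => ⟨u, hu, h.symm⟩⟩
  rw [macdonaldSum, h, sum_map]
  refine sum_congr rfl fun J _ => ?_
  simp [crossRatio, ← Finset.map_sdiff]

/-- With fewer than `|I|` values `u_a`, the generating sum at `s = -1` vanishes. -/
theorem macdonaldSum_neg_one_eq_zero {k : ℕ} (t : K) (x : ι → K) (I : Finset ι)
    (hx : Set.InjOn x I) (hI : #I = k + 1) (u : Fin k → K) (hu : ∀ a, ∀ i ∈ I, u a ≠ t * x i) :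
    macdonaldSum t (-1) x (fun i => ∏ a, (u a - x i) / (u a - t * x i)) I = 0 := by
  set e : Fin (k + 1) ↪ ι := (I.equivFinOfCardEq hI).symm.toEmbedding.trans
    (Function.Embedding.subtype _) with he
  have hmap : I = univ.map e := by
    ext i
    simp only [he, Finset.mem_map, mem_univ, true_and, Function.Embedding.trans_apply]
    constructor
    · intro hi
      exact ⟨I.equivFinOfCardEq hI ⟨i, hi⟩, by simp⟩
    · rintro ⟨a, rfl⟩
      exact ((I.equivFinOfCardEq hI).symm a).2
  have hmem : ∀ a, e a ∈ I := fun a => ((I.equivFinOfCardEq hI).symm a).2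
  have hxe : Function.Injective (x ∘ e) := fun a b h =>
    e.injective (hx (hmem a) (hmem b) h)
  rw [hmap, macdonaldSum_map]
  have hV : (Matrix.vandermonde (x ∘ e)).det ≠ 0 := Matrix.det_vandermonde_ne_zero_iff.mpr hxe
  refine (mul_eq_zero.mp ?_).resolve_right hV
  rw [macdonaldSum_mul_det_vandermonde t _ _ _ hxe, ← Matrix.exists_mulVec_eq_zero_iff]
  -- The coefficients of `U` form a kernel vector: row `i` pairs with them to `U(x_i) - w_i U(t
  -- x_i)`, which is `0` since `w_i = U(x_i) / U(t x_i)`. The vector has `k + 1` entries, the last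
  -- being `1`.
  set U : K[X] := ∏ a, (X - C (u a)) with hU
  have hUm : U.Monic := monic_prod_of_monic _ _ fun a _ => monic_X_sub_C _
  have hUd : U.natDegree = k := by
    rw [hU, natDegree_prod_of_monic _ _ fun a _ => monic_X_sub_C _]; simp
  have hUe : ∀ z, U.eval z = ∑ j : Fin (k + 1), z ^ (j : ℕ) * U.coeff j := by
    intro z
    rw [eval_eq_sum_range, hUd, sum_range]
    exact sum_congr rfl fun j _ => mul_comm _ _
  refine ⟨fun j => U.coeff j, fun h => ?_, ?_⟩
  · have := congrFun h (Fin.last k)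
    simp only [Fin.val_last, Pi.zero_apply] at this
    rw [← hUd, coeff_natDegree, hUm.leadingCoeff] at this
    exact one_ne_zero this
  · ext i
    have h1 : ∏ a, (u a - t * x (e i)) ≠ 0 :=
      prod_ne_zero_iff.mpr fun a _ => sub_ne_zero.mpr (hu a _ (hmem i))
    have h2 : ∀ z, ∏ a, (u a - z) = (-1) ^ k * U.eval z := by
      intro z
      rw [hU, eval_prod, ← Fin.prod_const, ← prod_mul_distrib]
      exact prod_congr rfl fun a _ => by simp
    simp only [Matrix.mulVec, dotProduct, Matrix.of_apply, Function.comp_apply, Pi.zero_apply,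
      add_mul, sum_add_distrib, mul_assoc]
    rw [← mul_sum, ← mul_sum, ← hUe, ← hUe, prod_div_distrib]
    rw [h2] at h1
    have h3 : (U.eval (t * x (e i))) ≠ 0 := right_ne_zero_of_mul h1
    rw [h2, h2]
    field_simp
    ring

/-! ### The creation sum as a polynomial in one additional variable -/

theorem crossRatio_insert_left (c d : K) (x : ι → K) {m : ι} {I : Finset ι} (hm : m ∉ I)
    (J : Finset ι) : crossRatio c d x (insert m I) J =
      (∏ j ∈ J, (c * x m - d * x j) / (x m - x j)) * crossRatio c d x I J :=
  prod_insert hm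

/-- The scalar by which the creation operator of `k`-subsets of `S` acts on a function that is
multiplied by `w_i` under the `q`-shift of `x_i`. -/
noncomputable def creationSum (t : K) (x w : ι → K) (S : Finset ι) (k : ℕ) : K :=
  ∑ I ∈ S.powersetCard k, (∏ i ∈ I, x i) * crossRatio 1 t⁻¹ x I (S \ I) *
    macdonaldSum t (-t) x w I

/-- The summand of `creationSum` for `J ⊆ I ⊆ S`. -/
noncomputable def creationTerm (t : K) (x w : ι → K) (S I J : Finset ι) : K :=
  (∏ i ∈ I, x i) * crossRatio 1 t⁻¹ x I (S \ I) *
    ((-t) ^ #J * t ^ (#J).choose 2 * crossRatio t 1 x J (I \ J) * ∏ i ∈ J, w i)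

theorem creationSum_eq_sum_term (t : K) (x w : ι → K) (S : Finset ι) (k : ℕ) :
    creationSum t x w S k =
      ∑ I ∈ S.powersetCard k, ∑ J ∈ I.powerset, creationTerm t x w S I J := by
  simp only [creationSum, macdonaldSum, creationTerm, mul_sum]

/-- `creationSum`, with a further factor `(v - x_i) / (v - t x_i)` in `w_i`, cleared of its
denominators as a function of `v`. -/
noncomputable def creationPoly (t : K) (x w : ι → K) (S : Finset ι) (k : ℕ) : K[X] :=
  ∑ I ∈ S.powersetCard k, ∑ J ∈ I.powerset, C (creationTerm t x w S I J) *
    ((∏ i ∈ J, (X - C (x i))) * ∏ i ∈ S \ J, (X - C (t * x i)))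

theorem natDegree_creationPoly_le (t : K) (x w : ι → K) (S : Finset ι) (k : ℕ) :
    (creationPoly t x w S k).natDegree ≤ #S := by
  refine natDegree_sum_le_of_forall_le _ _ fun I hI => natDegree_sum_le_of_forall_le _ _
    fun J hJ => (natDegree_C_mul_le _ _).trans ?_
  have hJS : J ⊆ S := (mem_powerset.mp hJ).trans (mem_powersetCard.mp hI).1
  refine natDegree_mul_le.trans ?_
  rw [natDegree_prod_of_monic _ _ fun a _ => monic_X_sub_C _,
    natDegree_prod_of_monic _ _ fun a _ => monic_X_sub_C _]
  simp only [natDegree_X_sub_C, sum_const, smul_eq_mul, mul_one]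
  rw [add_comm, card_sdiff_add_card_eq_card hJS]

theorem eval_creationPoly (t : K) (x w : ι → K) (S : Finset ι) (k : ℕ) (v : K)
    (hv : ∀ i ∈ S, v ≠ t * x i) :
    (creationPoly t x w S k).eval v =
      creationSum t x (fun i => (v - x i) / (v - t * x i) * w i) S k *
        ∏ i ∈ S, (v - t * x i) := by
  rw [creationSum_eq_sum_term, creationPoly, eval_finsetSum, sum_mul]
  refine sum_congr rfl fun I hI => ?_
  rw [eval_finsetSum, sum_mul]
  refine sum_congr rfl fun J hJ => ?_
  have hJS : J ⊆ S := (mem_powerset.mp hJ).trans (mem_powersetCard.mp hI).1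
  have h : ∏ i ∈ J, (v - x i) = (∏ i ∈ J, (v - x i) / (v - t * x i)) * ∏ i ∈ J, (v - t * x i) := by
    rw [← prod_mul_distrib]
    exact prod_congr rfl fun i hi => (div_mul_cancel₀ _ (sub_ne_zero.mpr (hv i (hJS hi)))).symm
  rw [← prod_sdiff hJS]
  simp only [eval_mul, eval_C, eval_prod, eval_sub, eval_X, creationTerm, prod_mul_distrib]
  rw [h]
  ring

/-- The cross ratios involving `x_m` cancel against the cleared denominators at `v = t x_m`, leaving
a factor that depends on `I` only through its size and not on `J`. The power of `t` collects `1`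
from `-t`, `|J|` from the binomial exponent and `|I ∖ J|` from the second cross ratio. -/
theorem creationTerm_insert (t : K) (ht : t ≠ 0) (x w : ι → K) {S I J : Finset ι} {m : ι}
    (hm : m ∉ S) (hx : ∀ i ∈ S, x m ≠ x i) (hI : I ⊆ S) (hJ : J ⊆ I) :
    creationTerm t x w (insert m S) (insert m I) (insert m J) *
      ((∏ i ∈ insert m J, (t * x m - x i)) * ∏ i ∈ S \ J, (t * x m - t * x i)) =
    -t ^ (#I + 1) * x m * (∏ i ∈ insert m S, (t * x m - x i)) * w m *
      creationTerm t x w S I J := by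
  have hmI : m ∉ I := fun h => hm (hI h)
  have hmJ : m ∉ J := fun h => hmI (hJ h)
  have hs1 : insert m S \ insert m I = S \ I := by
    rw [insert_sdiff_insert, sdiff_insert_of_notMem hm]
  have hs2 : insert m I \ insert m J = I \ J := by
    rw [insert_sdiff_insert, sdiff_insert_of_notMem hmI]
  have hsub : I \ J ⊆ S \ J := sdiff_subset_sdiff hI le_rfl
  have hs3 : (S \ J) \ (I \ J) = S \ I := by
    ext a
    simp only [mem_sdiff]
    exact ⟨fun h => ⟨h.1.1, fun ha => h.2 ⟨ha, h.1.2⟩⟩,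
      fun h => ⟨⟨h.1, fun ha => h.2 (hJ ha)⟩, fun ha => h.2 ha.1⟩⟩
  have e1 : (∏ j ∈ S \ I, (1 * x m - t⁻¹ * x j) / (x m - x j)) *
      ∏ j ∈ S \ I, (t * x m - t * x j) = ∏ j ∈ S \ I, (t * x m - x j) := by
    rw [← prod_mul_distrib]
    refine prod_congr rfl fun j hj => ?_
    have := sub_ne_zero.mpr (hx j (mem_sdiff.mp hj).1)
    field_simp
  have e2 : (∏ j ∈ I \ J, (t * x m - 1 * x j) / (x m - x j)) *
      ∏ j ∈ I \ J, (t * x m - t * x j) = t ^ #(I \ J) * ∏ j ∈ I \ J, (t * x m - x j) := by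
    rw [← prod_mul_distrib, ← prod_const, ← prod_mul_distrib]
    refine prod_congr rfl fun j hj => ?_
    have := sub_ne_zero.mpr (hx j (hI (mem_sdiff.mp hj).1))
    field_simp
  have e3 : ∏ j ∈ S, (t * x m - x j) = (∏ j ∈ S \ I, (t * x m - x j)) *
      ((∏ j ∈ I \ J, (t * x m - x j)) * ∏ j ∈ J, (t * x m - x j)) := by
    rw [prod_sdiff hJ, prod_sdiff hI]
  have hc : #I = #(I \ J) + #J := (card_sdiff_add_card_eq_card hJ).symm
  rw [creationTerm, creationTerm, hs1, hs2, prod_insert hmI, prod_insert hmJ, prod_insert hmJ,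
    prod_insert hm, crossRatio_insert_left _ _ _ hmI, crossRatio_insert_left _ _ _ hmJ,
    card_insert_of_notMem hmJ, ← prod_sdiff hsub, hs3, e3, ← e1, Nat.choose_succ_succ' _ 1,
    Nat.choose_one_right, hc]
  calc _ = (x m * ∏ i ∈ I, x i) * ((∏ j ∈ S \ I, (1 * x m - t⁻¹ * x j) / (x m - x j)) *
        ∏ j ∈ S \ I, (t * x m - t * x j)) * crossRatio 1 t⁻¹ x I (S \ I) *
        ((-t) ^ (#J + 1) * t ^ (#J + (#J).choose 2) *
          ((∏ j ∈ I \ J, (t * x m - 1 * x j) / (x m - x j)) * ∏ j ∈ I \ J, (t * x m - t * x j)) *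
          crossRatio t 1 x J (I \ J)) * (w m * ∏ i ∈ J, w i) *
          ((t * x m - x m) * ∏ j ∈ J, (t * x m - x j)) := by ring
    _ = _ := by rw [e2]; ring

/-- At `v = t x_m` the factor `v - t x_m` kills every term with `m ∉ J`; the survivors are matched
by `creationTerm_insert` with the terms for the smaller set. -/
theorem eval_creationPoly_mul (t : K) (ht : t ≠ 0) (x w : ι → K) (S : Finset ι) (k : ℕ) (m : ι)
    (hm : m ∉ S) (hx : ∀ i ∈ S, x m ≠ x i) :
    (creationPoly t x w (insert m S) (k + 1)).eval (t * x m) =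
      -t ^ (k + 1) * x m * (∏ i ∈ insert m S, (t * x m - x i)) * w m * creationSum t x w S k := by
  have hzero : ∀ I J : Finset ι, m ∉ J →
      ((∏ i ∈ J, (X - C (x i))) * ∏ i ∈ insert m S \ J, (X - C (t * x i))).eval (t * x m) = 0 := by
    intro I J hJ
    rw [eval_mul, eval_prod, eval_prod]
    refine mul_eq_zero_of_right _ (prod_eq_zero (i := m) ?_ (by simp))
    simp [hJ]
  rw [creationPoly, eval_finsetSum, powersetCard_succ_insert hm, sum_union, sum_eq_zero, zero_add,
    sum_image, creationSum_eq_sum_term, mul_sum]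
  · refine sum_congr rfl fun I hI => ?_
    obtain ⟨hIS, hIk⟩ := mem_powersetCard.mp hI
    have hmI : m ∉ I := fun h => hm (hIS h)
    rw [eval_finsetSum, sum_powerset_insert hmI, sum_eq_zero, zero_add, mul_sum]
    · refine sum_congr rfl fun J hJ => ?_
      have hJI := mem_powerset.mp hJ
      have hmJ : m ∉ J := fun h => hmI (hJI h)
      have h := creationTerm_insert t ht x w hm hx hIS hJI
      rw [hIk] at h
      rw [← h, insert_sdiff_insert, sdiff_insert_of_notMem hm]
      simp [eval_prod]
    · intro J hJ
      rw [eval_mul, hzero I J fun h => hmI (mem_powerset.mp hJ h), mul_zero]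
  · intro I hI I' hI' h
    have h1 : m ∉ I := fun h => hm ((mem_powersetCard.mp hI).1 h)
    have h2 : m ∉ I' := fun h => hm ((mem_powersetCard.mp hI').1 h)
    rw [← erase_insert h1, ← erase_insert h2]
    exact congrArg (fun A => A.erase m) h
  · intro I hI
    rw [eval_finsetSum]
    refine sum_eq_zero fun J hJ => ?_
    rw [eval_mul, hzero I J fun h => hm ((mem_powersetCard.mp hI).1 (mem_powerset.mp hJ h)),
      mul_zero]
  · rw [disjoint_left]
    intro I hI hI'
    obtain ⟨I', _, rfl⟩ := mem_image.mp hI'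
    exact hm ((mem_powersetCard.mp hI).1 (mem_insert_self m I'))

/-- At `v = 0` each extra factor `(v - x_i) / (v - t x_i)` is `1 / t`, turning the parameter `-t` of
the Macdonald sums into `-1`. Each `I` has one element more than there are `u`'s, so every sum
vanishes by `macdonaldSum_neg_one_eq_zero`. -/
theorem eval_zero_creationPoly {k : ℕ} (t : K) (ht : t ≠ 0) (x : ι → K) (S : Finset ι)
    (hx : Set.InjOn x S) (hx0 : ∀ i ∈ S, x i ≠ 0) (u : Fin k → K)
    (hu : ∀ a, ∀ i ∈ S, u a ≠ t * x i) :
    (creationPoly t x (fun i => ∏ a, (u a - x i) / (u a - t * x i)) S (k + 1)).eval 0 = 0 := by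
  rw [eval_creationPoly _ _ _ _ _ _ fun i hi => (mul_ne_zero ht (hx0 i hi)).symm, creationSum,
    sum_eq_zero, zero_mul]
  intro I hI
  obtain ⟨hIS, hIk⟩ := mem_powersetCard.mp hI
  have h := macdonaldSum_neg_one_eq_zero t x I (hx.mono (coe_subset.mpr hIS)) hIk u
    fun a i hi => hu a i (hIS hi)
  refine mul_eq_zero_of_right _ (Eq.trans ?_ h)
  refine sum_congr rfl fun J hJ => ?_
  have e : ∏ i ∈ J, (0 - x i) / (0 - t * x i) = (t⁻¹) ^ #J := by
    rw [← prod_const]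
    refine prod_congr rfl fun i hi => ?_
    have := hx0 i (hIS (mem_powerset.mp hJ hi))
    field_simp
    ring
  rw [prod_mul_distrib, e]
  have : (-t) ^ #J * t⁻¹ ^ #J = (-1) ^ #J := by
    rw [← mul_pow]
    congr 1
    field_simp
  rw [← this]
  ring

/-! ### Bordered determinants and the rational function identity -/

/-- The matrix `A` with the row `r` put on top. -/
def consRow {α : Type*} {k : ℕ} (r : Fin (k + 1) → α) (A : Matrix (Fin k) (Fin (k + 1)) α) :
    Matrix (Fin (k + 1)) (Fin (k + 1)) α :=
  Matrix.of fun i j => Fin.cases (r j) (fun a => A a j) i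

@[simp] theorem consRow_zero {α : Type*} {k : ℕ} (r : Fin (k + 1) → α) (A : Matrix (Fin k) (Fin (k + 1)) α)
    (j : Fin (k + 1)) : consRow r A 0 j = r j := rfl

@[simp] theorem consRow_succ {α : Type*} {k : ℕ} (r : Fin (k + 1) → α) (A : Matrix (Fin k) (Fin (k + 1)) α)
    (a : Fin k) (j : Fin (k + 1)) : consRow r A a.succ j = A a j := rfl

theorem det_consRow {k : ℕ} (r : Fin (k + 1) → K) (A : Matrix (Fin k) (Fin (k + 1)) K) :
    (consRow r A).det = ∑ j : Fin (k + 1), (-1) ^ (j : ℕ) * r j *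
      (A.submatrix id j.succAbove).det :=
  Matrix.det_succ_row_zero _

theorem det_consRow_mul {k : ℕ} (c : K) (r : Fin (k + 1) → K)
    (A : Matrix (Fin k) (Fin (k + 1)) K) :
    (consRow (fun j => c * r j) A).det = c * (consRow r A).det := by
  rw [det_consRow, det_consRow, mul_sum]
  exact sum_congr rfl fun j _ => by ring

/-- The matrix of the creation operator, for the values `u_a` of the inverse variables and
the eigenvalues `φ_a` of the `q`-shift of all the variables. -/
def creationMatrix {l k : ℕ} (t : K) (u φ : Fin l → K) : Matrix (Fin l) (Fin k) K :=
  Matrix.of fun a j => u a ^ ((j : ℕ) + 1) * (1 - t ^ (k - ((j : ℕ) + 1)) * φ a)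

/-- Removing the variable `x_m`, by column operations. -/
theorem det_consRow_pow_creationMatrix {k : ℕ} (t z : K) (u φ φ' : Fin k → K)
    (h : ∀ a, φ a * (u a - t * z) = φ' a * (u a - z)) :
    (consRow (fun j => z ^ (j : ℕ)) (creationMatrix t u φ)).det =
      (∏ a, (u a - z)) * (creationMatrix (k := k) t u φ').det := by
  set A : Matrix (Fin (k + 1)) (Fin (k + 1)) K :=
    consRow (fun j => z ^ (j : ℕ)) (creationMatrix t u φ) with hA
  -- Subtracting `z` times the preceding column makes the top row `(1, 0, …, 0)`. Below it, `(u - z)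
  -- - t^e φ (u - t z)` appears, which `h` turns into `(u - z)(1 - t^e φ')`.
  set B : Matrix (Fin (k + 1)) (Fin (k + 1)) K :=
    Matrix.of fun i j => Fin.cases (A i 0) (fun j => A i j.succ - z * A i j.castSucc) j with hB
  have hAB : A.det = B.det := by
    refine Matrix.det_eq_of_forall_col_eq_smul_add_pred (fun _ => z) (fun i => ?_) fun i j => ?_
    · simp [hB]
    · simp [hB]
  have hB0 : ∀ j : Fin k, B 0 j.succ = 0 := by
    intro j
    simp [hB, hA, pow_succ']
  rw [hAB, Matrix.det_succ_row_zero, Fin.sum_univ_succ, sum_eq_zero, add_zero]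
  · have h00 : B 0 0 = 1 := by simp [hB, hA]
    rw [h00, ← Matrix.det_mul_column]
    simp only [Fin.val_zero, pow_zero, one_mul]
    congr 1
    ext a j
    have hj : k + 1 - ((j : ℕ) + 1) = (k - ((j : ℕ) + 1)) + 1 := by omega
    have hj' : k + 1 - ((j : ℕ) + 1 + 1) = k - ((j : ℕ) + 1) := by omega
    simp only [Fin.succAbove_zero, Matrix.submatrix_apply, hB, hA, Matrix.of_apply, Fin.cases_succ,
      consRow_succ, creationMatrix, Fin.val_succ, Fin.val_castSucc, hj, hj']
    linear_combination (-(u a ^ ((j : ℕ) + 1)) * t ^ (k - ((j : ℕ) + 1))) * h a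
  · intro j _
    rw [hB0, mul_zero, zero_mul]

/-- The rational function identity that underlies the action of the creation operator. -/
theorem creationSum_mul_det_vandermonde {k : ℕ} (t : K) (ht : t ≠ 0) (x : ι → K) (S : Finset ι)
    (hx : Set.InjOn x S) (hx0 : ∀ i ∈ S, x i ≠ 0) (u : Fin k → K) (hu : Function.Injective u)
    (hu0 : ∀ a, u a ≠ 0) (hux : ∀ a, ∀ i ∈ S, u a ≠ t * x i) :
    creationSum t x (fun i => ∏ a, (u a - x i) / (u a - t * x i)) S k *
        (Matrix.vandermonde u).det =
      (creationMatrix (k := k) t u fun a => ∏ i ∈ S, (u a - x i) / (u a - t * x i)).det := by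
  classical
  induction k generalizing S with
  | zero => simp [creationSum, macdonaldSum, crossRatio]
  | succ k ih =>
    set u' : Fin k → K := fun a => u a.succ with hu'
    set φ : K → K := fun v => ∏ i ∈ S, (v - x i) / (v - t * x i) with hφ
    set w : ι → K := fun i => ∏ a, (u' a - x i) / (u' a - t * x i) with hw
    set N : K[X] := ∏ i ∈ S, (X - C (x i)) with hN
    set Q : K[X] := ∏ i ∈ S, (X - C (t * x i)) with hQ
    have hNm : N.Monic := monic_prod_of_monic _ _ fun a _ => monic_X_sub_C _
    have hQm : Q.Monic := monic_prod_of_monic _ _ fun a _ => monic_X_sub_C _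
    have hNd : N.natDegree = #S := by
      rw [hN, natDegree_prod_of_monic _ _ fun a _ => monic_X_sub_C _]
      simp only [natDegree_X_sub_C, sum_const, smul_eq_mul, mul_one]
    have hQd : Q.natDegree = #S := by
      rw [hQ, natDegree_prod_of_monic _ _ fun a _ => monic_X_sub_C _]
      simp only [natDegree_X_sub_C, sum_const, smul_eq_mul, mul_one]
    have hQ0 : ∀ v, (∀ i ∈ S, v ≠ t * x i) → Q.eval v ≠ 0 := by
      intro v hv
      rw [hQ, eval_prod]
      exact prod_ne_zero_iff.mpr fun i hi => by simpa using sub_ne_zero.mpr (hv i hi)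
    have hφQ : ∀ v, (∀ i ∈ S, v ≠ t * x i) → N.eval v = Q.eval v * φ v := by
      intro v hv
      rw [hN, hQ, eval_prod, eval_prod, ← prod_mul_distrib]
      refine prod_congr rfl fun i hi => ?_
      simp only [eval_sub, eval_X, eval_C]
      exact (mul_div_cancel₀ _ (sub_ne_zero.mpr (hv i hi))).symm
    set q : Fin (k + 1) → K[X] :=
      fun j => X ^ ((j : ℕ) + 1) * (Q - C (t ^ (k + 1 - ((j : ℕ) + 1))) * N) with hq
    set A : Matrix (Fin k) (Fin (k + 1)) K := creationMatrix t u' fun a => φ (u' a) with hA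
    -- `Lp` and `Rp` are the two sides with `u 0` replaced by an indeterminate and multiplied by
    -- `Q`. The last two factors of `Lp` make up the Vandermonde determinant; `Rp` is the Laplace
    -- expansion along the top row.
    set Lp : K[X] := creationPoly t x w S (k + 1) * C (Matrix.vandermonde u').det *
      ∏ a, (C (u' a) - X) with hLp
    set Rp : K[X] :=
      ∑ j : Fin (k + 1), C ((-1) ^ (j : ℕ) * (A.submatrix id j.succAbove).det) * q j with hRp
    have hR : ∀ z, Rp.eval z = (consRow (fun j => (q j).eval z) A).det := by
      intro z
      rw [det_consRow, hRp, eval_finsetSum]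
      refine sum_congr rfl fun j _ => ?_
      rw [eval_mul, eval_C, mul_right_comm]
    have hqv : ∀ v, (∀ i ∈ S, v ≠ t * x i) → ∀ j, (q j).eval v =
        Q.eval v * (v ^ ((j : ℕ) + 1) * (1 - t ^ (k + 1 - ((j : ℕ) + 1)) * φ v)) := by
      intro v hv j
      simp only [hq, eval_mul, eval_pow, eval_X, eval_sub, eval_C]
      rw [hφQ v hv]
      ring
    set T : Finset K := insert 0 (univ.image u' ∪ S.image fun i => t * x i) with hT
    have hTc : #T = #S + k + 1 := by
      rw [hT, card_insert_of_notMem, card_union_of_disjoint, card_image_of_injective,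
        card_image_of_injOn, card_univ, Fintype.card_fin, add_comm k]
      · exact fun i hi j hj h => hx hi hj (mul_left_cancel₀ ht h)
      · exact fun a b h => Fin.succ_injective _ (hu h)
      · rw [disjoint_left]
        intro z hz hz'
        obtain ⟨a, _, rfl⟩ := mem_image.mp hz
        obtain ⟨i, hi, h⟩ := mem_image.mp hz'
        exact hux _ i hi h.symm
      · intro h
        rcases mem_union.mp h with h | h
        · obtain ⟨a, _, h⟩ := mem_image.mp h
          exact hu0 _ h
        · obtain ⟨i, hi, h⟩ := mem_image.mp h
          exact mul_ne_zero ht (hx0 i hi) h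
    have hLd : Lp.natDegree ≤ #S + k := by
      refine natDegree_mul_le.trans (Nat.add_le_add ((natDegree_mul_C_le _ _).trans
        (natDegree_creationPoly_le _ _ _ _ _)) ?_)
      refine (natDegree_prod_le _ _).trans ?_
      refine (sum_le_card_nsmul _ _ 1 fun a _ => ?_).trans (by simp)
      compute_degree
    have hRd : Rp.natDegree ≤ #S + k := by
      refine natDegree_sum_le_of_forall_le _ _ fun j _ => (natDegree_C_mul_le _ _).trans ?_
      rcases Nat.lt_or_ge (j : ℕ) k with hj | hj
      · have h1 : (Q - C (t ^ (k + 1 - ((j : ℕ) + 1))) * N).natDegree ≤ #S :=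
          (natDegree_sub_le_of_le hQd.le ((natDegree_C_mul_le _ _).trans hNd.le)).trans
            (max_self _).le
        refine natDegree_mul_le.trans ?_
        rw [natDegree_X_pow]
        omega
      · have hj' : (j : ℕ) = k := by omega
        simp only [hq, hj', Nat.sub_self, pow_zero, C_1, one_mul]
        by_cases hQN : Q - N = 0
        · simp [hQN]
        have h1 : (Q - N).degree < Q.degree := degree_sub_lt_left
          (by rw [degree_eq_natDegree hQm.ne_zero, degree_eq_natDegree hNm.ne_zero, hQd, hNd])
          hQm.ne_zero (by rw [hQm.leadingCoeff, hNm.leadingCoeff])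
        have h2 := natDegree_lt_natDegree hQN h1
        refine natDegree_mul_le.trans ?_
        rw [natDegree_X_pow]
        omega
    have hpoly : Lp = Rp := by
      refine eq_of_degrees_lt_of_eval_finset_eq T ?_ ?_ ?_
      · rw [hTc]
        exact degree_le_natDegree.trans_lt (by exact_mod_cast Nat.lt_succ_of_le hLd)
      · rw [hTc]
        exact degree_le_natDegree.trans_lt (by exact_mod_cast Nat.lt_succ_of_le hRd)
      intro z hz
      rw [hR]
      rcases mem_insert.mp hz with rfl | hz
      · rw [Matrix.det_eq_zero_of_row_eq_zero 0 fun j => by simp [hq], hLp, eval_mul, eval_mul,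
          eval_zero_creationPoly t ht x S hx hx0 u' fun a => hux _, zero_mul, zero_mul]
      rcases mem_union.mp hz with hz | hz
      -- At another `u` the top row repeats row `b` up to a scalar, and the Vandermonde factor on
      -- the left vanishes.
      · obtain ⟨b, _, rfl⟩ := mem_image.mp hz
        have h1 : ∏ a, (u' a - u' b) = 0 := prod_eq_zero (mem_univ b) (sub_self _)
        have h2 : (consRow (fun j => (q j).eval (u' b)) A).det =
            Q.eval (u' b) * (consRow (A b) A).det := by
          rw [← det_consRow_mul]
          congr 2
          funext j
          exact hqv _ (hux _) j
        rw [h2, Matrix.det_zero_of_row_eq (i := 0) (j := b.succ) (Fin.succ_ne_zero b).symm rfl,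
          mul_zero, hLp, eval_mul, eval_prod]
        simp [h1]
      · obtain ⟨m, hm, rfl⟩ := mem_image.mp hz
        have hmS := notMem_erase m S
        have hxm : ∀ i ∈ S.erase m, x m ≠ x i := fun i hi h =>
          (mem_erase.mp hi).1 (hx (mem_of_mem_erase hi) hm h.symm)
        have hum : ∀ a, u' a - t * x m ≠ 0 := fun a => sub_ne_zero.mpr (hux _ m hm)
        have hih := ih (S.erase m) (hx.mono (by simp)) (fun i hi => hx0 i (mem_of_mem_erase hi)) u'
          (fun a b h => Fin.succ_injective _ (hu h)) (fun a => hu0 _)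
          fun a i hi => hux _ i (mem_of_mem_erase hi)
        have hev := eval_creationPoly_mul t ht x w (S.erase m) k m hmS hxm
        rw [insert_erase hm] at hev
        have hQm0 : Q.eval (t * x m) = 0 := by
          rw [hQ, eval_prod]
          exact prod_eq_zero hm (by simp)
        have h2 : (consRow (fun j => (q j).eval (t * x m)) A).det =
            -t ^ (k + 1) * x m * N.eval (t * x m) *
              (consRow (fun j => x m ^ (j : ℕ)) A).det := by
          rw [← det_consRow_mul]
          congr 2
          funext j
          -- Since `Q` vanishes at `t x_m`, only the `N` term is left. The `t^{j+1}` from `(t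
          -- x_m)^{j+1}` completes its power of `t` to `t^{k+1}` in every column, so the top row is
          -- proportional to the powers of `x_m`.
          have hkj : t ^ (k + 1) = t ^ (k + 1 - ((j : ℕ) + 1)) * t ^ ((j : ℕ) + 1) := by
            rw [← pow_add]; congr 1; omega
          simp only [hq, eval_mul, eval_pow, eval_X, eval_sub, eval_C, hQm0]
          rw [hkj]
          ring
        rw [h2, det_consRow_pow_creationMatrix t (x m) u' _
          (fun a => ∏ i ∈ S.erase m, (u' a - x i) / (u' a - t * x i)), ← hih, hLp, eval_mul,
          eval_mul, eval_C, hev, hN, eval_prod, eval_prod, hw]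
        · have h4 : (∏ a, (u' a - x m) / (u' a - t * x m)) * ∏ a, (u' a - t * x m) =
              ∏ a, (u' a - x m) := by
            rw [← prod_mul_distrib]
            exact prod_congr rfl fun a _ => div_mul_cancel₀ _ (hum a)
          simp only [eval_sub, eval_X, eval_C]
          rw [← h4]
          ring
        · intro a
          simp only [hφ]
          rw [← mul_prod_erase S _ hm]
          rw [mul_right_comm, div_mul_cancel₀ _ (hum a), mul_comm]
    have hfin := congrArg (eval (u 0)) hpoly
    have h5 : (consRow (fun j => (q j).eval (u 0)) A).det =
        Q.eval (u 0) * (creationMatrix (k := k + 1) t u fun a => φ (u a)).det := by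
      have h7 : (creationMatrix (k := k + 1) t u fun a => φ (u a)) = consRow
          (fun j => u 0 ^ ((j : ℕ) + 1) * (1 - t ^ (k + 1 - ((j : ℕ) + 1)) * φ (u 0))) A := by
        ext a j
        refine Fin.cases ?_ (fun a => ?_) a <;> rfl
      rw [h7, ← det_consRow_mul]
      congr 2
      funext j
      exact hqv _ (hux 0) j
    rw [hR, h5, hLp, eval_mul, eval_mul, eval_C, eval_creationPoly _ _ _ _ _ _ (hux 0)] at hfin
    refine mul_left_cancel₀ (hQ0 _ (hux 0)) (Eq.trans ?_ hfin)
    have h6 : (Matrix.vandermonde u).det = (∏ a, (u' a - u 0)) * (Matrix.vandermonde u').det := by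
      rw [Matrix.det_vandermonde, Matrix.det_vandermonde, Fin.prod_univ_succ]
      congr 1
      · rw [Fin.prod_Ioi_zero]
      · refine prod_congr rfl fun i _ => ?_
        rw [Fin.prod_Ioi_succ]
    rw [h6, hQ, eval_prod, eval_prod]
    simp only [eval_sub, eval_X, eval_C, hw, Fin.prod_univ_succ, hu']
    ring

end Core

end Creation

namespace Creation

/-! ### From evaluation at points to linear functionals -/

section Core

open Finset Polynomial

variable {K ι : Type*} [Field K]

/-- Lagrange interpolation at `N` nodes outside `B`; the weight of a node is the value of `L` on its
basis polynomial. The nodes do not depend on `L`, so one set serves all rows of a determinant. -/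
theorem exists_linearMap_eq_sum_eval [Infinite K] (B : Finset K) (N : ℕ) :
    ∃ Z : Finset K, (∀ z ∈ Z, z ∉ B) ∧ ∀ L : K[X] →ₗ[K] K, ∃ w : K → K,
      ∀ p : K[X], p.degree < N → L p = ∑ z ∈ Z, w z * p.eval z := by
  classical
  obtain ⟨Z, hZ, hZN⟩ := (B.finite_toSet.infinite_compl).exists_subset_card_eq N
  refine ⟨Z, fun z hz => hZ hz, fun L => ⟨fun z => L (Lagrange.basis Z id z), fun p hp => ?_⟩⟩
  conv_lhs => rw [Lagrange.eq_interpolate (s := Z) (v := id) (f := p) (Set.injOn_id _)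
    (by rwa [hZN]), Lagrange.interpolate_apply, map_sum]
  refine sum_congr rfl fun z _ => ?_
  rw [← smul_eq_C_mul, map_smul, smul_eq_mul, mul_comm, id]

/-- A linear relation between determinants in polynomials of one variable per row, if it holds at
general points, is preserved when a linear functional is applied in each row. -/
theorem sum_det_linearMap_eq [Infinite K] {k : ℕ} {τ : Type*} (σ : Finset τ) (c : τ → K)
    (p : τ → Fin k → K[X]) (r : Fin k → K[X]) (B : Finset K)
    (h : ∀ y : Fin k → K, (∀ a, y a ∉ B) →
      ∑ s ∈ σ, c s * (Matrix.of fun a j => (p s j).eval (y a)).det =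
        (Matrix.of fun a j => (r j).eval (y a)).det) (L : Fin k → K[X] →ₗ[K] K) :
    ∑ s ∈ σ, c s * (Matrix.of fun a j => L a (p s j)).det =
      (Matrix.of fun a j => L a (r j)).det := by
  classical
  set N := ∑ s ∈ σ, ∑ j, (p s j).natDegree + ∑ j, (r j).natDegree + 1 with hN
  have hlt : ∀ f : K[X], f.natDegree < N → f.degree < N := fun f hf =>
    degree_le_natDegree.trans_lt (by exact_mod_cast hf)
  have hp : ∀ s ∈ σ, ∀ j, (p s j).degree < N := by
    intro s hs j
    refine hlt _ ?_
    have h1 := single_le_sum (f := fun j => (p s j).natDegree) (fun _ _ => Nat.zero_le _)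
      (mem_univ j)
    have h2 := single_le_sum (f := fun s => ∑ j, (p s j).natDegree) (fun _ _ => Nat.zero_le _) hs
    omega
  have hr : ∀ j, (r j).degree < N := by
    intro j
    refine hlt _ ?_
    have h1 := single_le_sum (f := fun j => (r j).natDegree) (fun _ _ => Nat.zero_le _)
      (mem_univ j)
    omega
  obtain ⟨Z, hZB, hZ⟩ := exists_linearMap_eq_sum_eval B N
  choose w hw using fun a => hZ (L a)
  have key : ∀ f : Fin k → K[X], (∀ j, (f j).degree < N) →
      (Matrix.of fun a j => L a (f j)).det = ∑ y ∈ Fintype.piFinset fun _ : Fin k => Z,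
        (∏ a, w a (y a)) * (Matrix.of fun a j => (f j).eval (y a)).det := by
    intro f hf
    have h1 : (Matrix.of fun a j => L a (f j)) =
        fun a => ∑ z ∈ Z, fun j => w a z * (f j).eval z := by
      ext a j
      rw [Matrix.of_apply, hw a _ (hf j), Finset.sum_apply]
    have h2 := (Matrix.detRowAlternating (R := K) (n := Fin k)).toMultilinearMap.map_sum_finset
      (fun a z j => w a z * (f j).eval z) (fun _ => Z)
    rw [h1]
    refine h2.trans (sum_congr rfl fun y _ => ?_)
    exact Matrix.det_mul_column (fun a => w a (y a)) (Matrix.of fun a j => (f j).eval (y a))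
  rw [key r hr, sum_congr rfl fun s hs => by rw [key _ (hp s hs), mul_sum], sum_comm]
  refine sum_congr rfl fun y hy => ?_
  rw [← h y fun a => hZB _ (Fintype.mem_piFinset.mp hy a), mul_sum]
  exact sum_congr rfl fun s _ => by ring

variable [DecidableEq ι]

/-- `∏_{i ∈ J} (1 - x_i y) ∏_{i ∈ S ∖ J} (1 - t x_i y)`, as a polynomial in `y`. -/
noncomputable def shiftPoly (t : K) (x : ι → K) (S J : Finset ι) : K[X] :=
  (∏ i ∈ J, (1 - C (x i) * X)) * ∏ i ∈ S \ J, (1 - C (t * x i) * X)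

theorem eval_shiftPoly (t : K) (x : ι → K) {S J : Finset ι} (hJ : J ⊆ S) (y : K) (hy : y ≠ 0)
    (hyx : ∀ i ∈ S, y⁻¹ ≠ t * x i) :
    (shiftPoly t x S J).eval y = (∏ i ∈ S, (1 - t * x i * y)) *
      ∏ i ∈ J, (y⁻¹ - x i) / (y⁻¹ - t * x i) := by
  rw [← prod_sdiff hJ, shiftPoly, mul_assoc, ← prod_mul_distrib, mul_comm]
  simp only [eval_mul, eval_prod, eval_sub, eval_one, eval_C, eval_X]
  congr 1
  refine prod_congr rfl fun i hi => ?_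
  have h1 := sub_ne_zero.mpr (hyx i (hJ hi))
  have h2 : 1 - t * x i * y = y * (y⁻¹ - t * x i) := by field_simp
  rw [h2, mul_assoc, mul_div_cancel₀ _ h1]
  field_simp

/-- The rational function identity behind the creation operator, in the variables `y_a = 1/u_a`
and cleared of its denominators. -/
theorem sum_creationTerm_mul_det_eval {k : ℕ} (t : K) (ht : t ≠ 0) (x : ι → K) (S : Finset ι)
    (hx : Set.InjOn x S) (hx0 : ∀ i ∈ S, x i ≠ 0) (y : Fin k → K) (hy : ∀ a, y a ≠ 0)
    (hyx : ∀ a, ∀ i ∈ S, (y a)⁻¹ ≠ t * x i) :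
    ∑ I ∈ S.powersetCard k, ∑ J ∈ I.powerset, creationTerm t x 1 S I J *
        (Matrix.of fun a j : Fin k => (X ^ (k - (j : ℕ)) * shiftPoly t x S J).eval (y a)).det =
      (Matrix.of fun a j : Fin k => (X ^ (k - ((j : ℕ) + 1)) * (shiftPoly t x S ∅ -
        C (t ^ (k - ((j : ℕ) + 1))) * shiftPoly t x S S)).eval (y a)).det := by
  by_cases hinj : Function.Injective y
  · set u : Fin k → K := fun a => (y a)⁻¹ with hu
    have hcore := creationSum_mul_det_vandermonde t ht x S hx hx0 u
      (fun a b h => hinj (inv_injective h)) (fun a => inv_ne_zero (hy a)) hyx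
    -- The factor of row `a` that converts powers of `u_a` into powers of `y_a` and clears the
    -- denominators of `φ`.
    set R : Fin k → K := fun a => y a ^ k * ∏ i ∈ S, (1 - t * x i * y a) with hR
    have hyu : ∀ a, y a * u a = 1 := fun a => mul_inv_cancel₀ (hy a)
    have h1 : (Matrix.of fun a j : Fin k => (X ^ (k - ((j : ℕ) + 1)) * (shiftPoly t x S ∅ -
        C (t ^ (k - ((j : ℕ) + 1))) * shiftPoly t x S S)).eval (y a)) =
        Matrix.of fun a j => R a * creationMatrix (k := k) t u
          (fun a => ∏ i ∈ S, (u a - x i) / (u a - t * x i)) a j := by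
      ext a j
      have hj : y a ^ k = y a ^ (k - ((j : ℕ) + 1)) * y a ^ ((j : ℕ) + 1) := by
        rw [← pow_add]; congr 1; omega
      have hj' : y a ^ ((j : ℕ) + 1) * u a ^ ((j : ℕ) + 1) = 1 := by
        rw [← mul_pow, hyu, one_pow]
      simp only [Matrix.of_apply, eval_mul, eval_pow, eval_X, eval_sub, eval_C, creationMatrix, hR]
      rw [eval_shiftPoly t x (empty_subset S) _ (hy a) (hyx a),
        eval_shiftPoly t x (subset_refl S) _ (hy a) (hyx a), prod_empty, mul_one, hj]
      linear_combination (-(y a ^ (k - ((j : ℕ) + 1))) * (∏ i ∈ S, (1 - t * x i * y a)) *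
        (1 - t ^ (k - ((j : ℕ) + 1)) * ∏ i ∈ S, (u a - x i) / (u a - t * x i))) * hj'
    rw [h1, Matrix.det_mul_column, ← hcore, creationSum_eq_sum_term, sum_mul, mul_sum]
    refine sum_congr rfl fun I hI => ?_
    rw [sum_mul, mul_sum]
    refine sum_congr rfl fun J hJ => ?_
    have hJS : J ⊆ S := (mem_powerset.mp hJ).trans (mem_powersetCard.mp hI).1
    have h2 : (Matrix.of fun a j : Fin k =>
        (X ^ (k - (j : ℕ)) * shiftPoly t x S J).eval (y a)) = Matrix.of fun a j =>
          (R a * ∏ i ∈ J, (u a - x i) / (u a - t * x i)) * Matrix.vandermonde u a j := by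
      ext a j
      have hj : y a ^ k = y a ^ (k - (j : ℕ)) * y a ^ (j : ℕ) := by
        rw [← pow_add]; congr 1; omega
      have hj' : y a ^ (j : ℕ) * u a ^ (j : ℕ) = 1 := by
        rw [← mul_pow, hyu, one_pow]
      simp only [Matrix.of_apply, eval_mul, eval_pow, eval_X, Matrix.vandermonde_apply, hR]
      rw [eval_shiftPoly t x hJS _ (hy a) (hyx a), hj]
      linear_combination (-(y a ^ (k - (j : ℕ))) * (∏ i ∈ S, (1 - t * x i * y a)) *
        ∏ i ∈ J, (u a - x i) / (u a - t * x i)) * hj'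
    rw [h2, Matrix.det_mul_column, prod_mul_distrib, prod_comm, creationTerm, creationTerm]
    simp only [Pi.one_apply, prod_const_one]
    ring
  · obtain ⟨a, b, hab, hne⟩ := Function.not_injective_iff.mp hinj
    rw [Matrix.det_zero_of_row_eq hne (by funext j; simp [hab])]
    refine sum_eq_zero fun I _ => sum_eq_zero fun J _ => ?_
    rw [Matrix.det_zero_of_row_eq hne (by funext j; simp [hab]), mul_zero]

theorem sum_creationTerm_mul_det_linearMap [Infinite K] {k : ℕ} (t : K) (ht : t ≠ 0) (x : ι → K)
    (S : Finset ι) (hx : Set.InjOn x S) (hx0 : ∀ i ∈ S, x i ≠ 0) (L : Fin k → K[X] →ₗ[K] K) :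
    ∑ I ∈ S.powersetCard k, ∑ J ∈ I.powerset, creationTerm t x 1 S I J *
        (Matrix.of fun a j : Fin k => L a (X ^ (k - (j : ℕ)) * shiftPoly t x S J)).det =
      (Matrix.of fun a j : Fin k => L a (X ^ (k - ((j : ℕ) + 1)) * (shiftPoly t x S ∅ -
        C (t ^ (k - ((j : ℕ) + 1))) * shiftPoly t x S S))).det := by
  classical
  rw [sum_sigma']
  refine sum_det_linearMap_eq _ (fun s : (_ : Finset ι) × Finset ι => creationTerm t x 1 S s.1 s.2)
    (fun s j => X ^ (k - (j : ℕ)) * shiftPoly t x S s.2) _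
    (insert 0 (S.image fun i => (t * x i)⁻¹)) (fun y hy => ?_) L
  rw [← sum_creationTerm_mul_det_eval t ht x S hx hx0 y
    (fun a h => hy a (by simp [h])) fun a i hi h => hy a ?_, sum_sigma']
  rw [mem_insert, mem_image]
  exact Or.inr ⟨i, hi, by rw [← h, inv_inv]⟩

end Core

end Creation

namespace Creation

/-! ### Generating series of the complete symmetric functions -/

section GeneratingFunction

open Finset PowerSeries

variable {K : Type*} [Field K] [Algebra ℝ K]

/-- The generating function `∑_m S_m y^m` for the values `p_i` of the power sums. -/
noncomputable def completeSeries (p : ℕ+ → K) : K⟦X⟧ :=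
  PowerSeries.mk fun m => MvPolynomial.aeval p (complete m)

theorem succ_mul_aeval_complete_succ (p : ℕ+ → K) (m : ℕ) :
    ((m : K) + 1) * MvPolynomial.aeval p (complete (m + 1)) =
      ∑ i ∈ range (m + 1), p i.succPNat * MvPolynomial.aeval p (complete (m - i)) := by
  have h0 : (m : ℝ) + 1 ≠ 0 := by positivity
  have h1 : (m : K) + 1 = algebraMap ℝ K (m + 1) := by simp
  rw [complete, map_mul, map_sum, MvPolynomial.aeval_C, h1, ← mul_assoc, ← map_mul,
    mul_inv_cancel₀ h0, map_one, one_mul, sum_range]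
  exact sum_congr rfl fun i _ => by rw [map_mul, powerSum, MvPolynomial.aeval_X]

theorem derivative_completeSeries (p : ℕ+ → K) :
    PowerSeries.derivative K (completeSeries p) =
      PowerSeries.mk (fun i => p i.succPNat) * completeSeries p := by
  ext m
  rw [coeff_derivative, coeff_mul, Finset.Nat.sum_antidiagonal_eq_sum_range_succ_mk, mul_comm]
  simp only [completeSeries, coeff_mk]
  exact succ_mul_aeval_complete_succ p m

theorem constantCoeff_completeSeries (p : ℕ+ → K) :
    constantCoeff (completeSeries p) = 1 := by
  simp [completeSeries, complete, ← coeff_zero_eq_constantCoeff_apply]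

/-- The equation determines `m + 1` times the coefficient of degree `m + 1` from the lower ones, and
`m + 1` is invertible in characteristic zero. -/
theorem eq_of_derivative_eq_mul {R : Type*} [Field R] [CharZero R] {P F G : R⟦X⟧}
    (hF : PowerSeries.derivative R F = P * F) (hG : PowerSeries.derivative R G = P * G)
    (h0 : constantCoeff F = constantCoeff G) : F = G := by
  ext m
  induction m using Nat.strong_induction_on with
  | _ m ih =>
    cases m with
    | zero => simpa using h0
    | succ m =>
      have h1 := congrArg (coeff m) hF
      have h2 := congrArg (coeff m) hG
      rw [coeff_derivative, coeff_mul] at h1 h2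
      have h3 : (m : R) + 1 ≠ 0 := by exact_mod_cast m.succ_ne_zero
      refine mul_right_cancel₀ h3 ?_
      rw [h1, h2]
      refine sum_congr rfl fun a ha => ?_
      rw [ih a.2 (by have := mem_antidiagonal.mp ha; omega)]

/-- Adding a variable `z` divides the series by `1 - z y`: the logarithmic derivative of `1 - z y`
cancels the additional power sums `∑ z^{i+1} y^i`, so both sides solve the same first order
equation. -/
theorem completeSeries_add_pow_mul [CharZero K] (p : ℕ+ → K) (z : K) :
    completeSeries (fun i => p i + z ^ (i : ℕ)) * (1 - C z * X) = completeSeries p := by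
  refine eq_of_derivative_eq_mul ?_ (derivative_completeSeries p) ?_
  · have hz : PowerSeries.mk (fun i => z ^ (i + 1)) * (1 - C z * X) = C z := by
      ext m
      cases m with
      | zero => simp [mul_sub, ← mul_assoc]
      | succ m =>
        rw [mul_sub, mul_one, ← mul_assoc, map_sub, coeff_succ_mul_X, mul_comm _ (C z),
          coeff_C_mul, coeff_mk, coeff_mk, coeff_C, if_neg m.succ_ne_zero]
        ring
    have hP : PowerSeries.mk (fun i : ℕ => p i.succPNat + z ^ (i.succPNat : ℕ)) =
        PowerSeries.mk (fun i => p i.succPNat) + PowerSeries.mk (fun i => z ^ (i + 1)) := by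
      ext m
      simp
    have hd : PowerSeries.derivative K (1 - C z * X) = -C z := by
      simp [Derivation.leibniz]
    rw [Derivation.leibniz, derivative_completeSeries, hP, hd, smul_eq_mul, smul_eq_mul]
    linear_combination
      (completeSeries (fun i => p i + z ^ (i : ℕ))) * hz
  · simp [constantCoeff_completeSeries]

/-- Exchanging variables `w_j` for `z_j`, `j ∈ J`, in the alphabet. -/
theorem completeSeries_exchange_mul [CharZero K] {ι : Type*} (p : ℕ+ → K) (z w : ι → K)
    (J : Finset ι) :
    completeSeries (fun i => p i + ∑ j ∈ J, (z j ^ (i : ℕ) - w j ^ (i : ℕ))) *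
        ∏ j ∈ J, (1 - C (z j) * X) =
      completeSeries p * ∏ j ∈ J, (1 - C (w j) * X) := by
  classical
  induction J using Finset.induction_on with
  | empty => simp
  | insert m J hm ih =>
    -- The common part of the two alphabets: adding `z m` to `r` gives the one for `insert m J`,
    -- adding `w m` gives the one for `J`.
    set r : ℕ+ → K := fun i => p i + ∑ j ∈ J, (z j ^ (i : ℕ) - w j ^ (i : ℕ)) - w m ^ (i : ℕ)
      with hr
    have h1 := completeSeries_add_pow_mul r (z m)
    have h2 := completeSeries_add_pow_mul r (w m)
    have e1 : (fun i => r i + z m ^ (i : ℕ)) =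
        fun i : ℕ+ => p i + ∑ j ∈ insert m J, (z j ^ (i : ℕ) - w j ^ (i : ℕ)) := by
      funext i
      rw [sum_insert hm]
      simp only [hr]
      ring
    have e2 : (fun i => r i + w m ^ (i : ℕ)) =
        fun i : ℕ+ => p i + ∑ j ∈ J, (z j ^ (i : ℕ) - w j ^ (i : ℕ)) := by
      funext i
      simp only [hr]
      ring
    rw [e1] at h1
    rw [e2] at h2
    rw [prod_insert hm, prod_insert hm, ← mul_assoc, h1, ← h2, mul_right_comm, ih]
    ring

theorem aeval_complete_scale (p : ℕ+ → K) [CharZero K] (q : K) (m : ℕ) :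
    MvPolynomial.aeval (fun i : ℕ+ => q ^ (i : ℕ) * p i) (complete m) =
      q ^ m * MvPolynomial.aeval p (complete m) := by
  induction m using Nat.strong_induction_on with
  | _ m ih =>
    cases m with
    | zero => simp [complete]
    | succ m =>
      have h3 : (m : K) + 1 ≠ 0 := by exact_mod_cast m.succ_ne_zero
      refine mul_left_cancel₀ h3 ?_
      rw [mul_left_comm, succ_mul_aeval_complete_succ, succ_mul_aeval_complete_succ, mul_sum]
      refine sum_congr rfl fun i hi => ?_
      have hi' := mem_range.mp hi
      rw [ih _ (by omega), Nat.succPNat_coe]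
      have : q ^ (m + 1) = q ^ (i + 1) * q ^ (m - i) := by rw [← pow_add]; congr 1; omega
      rw [this]
      simp only [Nat.succ_eq_add_one]
      ring

theorem aeval_completeZ_scale (p : ℕ+ → K) [CharZero K] (q : K) (m : ℤ) :
    MvPolynomial.aeval (fun i : ℕ+ => q ^ (i : ℕ) * p i) (completeZ m) =
      q ^ m * MvPolynomial.aeval p (completeZ m) := by
  cases m with
  | ofNat m => simpa [completeZ] using aeval_complete_scale p q m
  | negSucc m => simp [completeZ]

theorem coeff_X_pow_mul_completeSeries (p : ℕ+ → K) (e M : ℕ) (m : ℤ) (hm : m + e = M) :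
    coeff M (X ^ e * completeSeries p) = MvPolynomial.aeval p (completeZ m) := by
  rw [coeff_X_pow_mul']
  cases m with
  | ofNat m =>
    simp only [Int.ofNat_eq_natCast] at hm
    rw [if_pos (by omega), completeSeries, coeff_mk]
    have : M - e = m := by omega
    rw [this]
    rfl
  | negSucc m =>
    rw [if_neg (by omega)]
    simp [completeZ]

end GeneratingFunction

theorem rowLen_eq_zero_of_numParts_le (lam : YoungDiagram) {i : ℕ} (hi : numParts lam ≤ i) :
    lam.rowLen i = 0 := by
  by_contra h
  have h1 : (i, 0) ∈ lam := YoungDiagram.mem_iff_lt_rowLen.mpr (Nat.pos_of_ne_zero h)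
  exact absurd (YoungDiagram.mem_iff_lt_colLen.mp h1) (not_lt.mpr hi)

/-- The Jacobi-Trudi determinant does not change when zero parts are added. -/
theorem schur_eq_det (lam : YoungDiagram) {k : ℕ} (hk : numParts lam ≤ k) :
    schur lam = (Matrix.of fun i j : Fin k =>
      completeZ ((lam.rowLen i : ℤ) + (j : ℤ) - (i : ℤ))).det := by
  induction k, hk using Nat.le_induction with
  | base => rfl
  | succ k hk ih =>
    -- The additional last row is `(0, …, 0, 1)`: its part is zero, so its indices are negative left
    -- of the diagonal.
    rw [ih, Matrix.det_succ_row _ (Fin.last k), Fin.sum_univ_castSucc, Finset.sum_eq_zero, zero_add]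
    · have h0 : completeZ 0 = 1 := by simp [completeZ, complete]
      simp only [Fin.val_last, Matrix.of_apply, Fin.succAbove_last,
        rowLen_eq_zero_of_numParts_le lam hk]
      rw [Even.neg_one_pow (Even.add_self k)]
      simp only [Nat.cast_zero, zero_add, sub_self, h0, one_mul]
      rfl
    · intro j _
      have h0 : completeZ ((j : ℤ) - k) = 0 := by
        have : (j : ℤ) - k < 0 := by omega
        obtain ⟨m, hm⟩ := Int.eq_negSucc_of_lt_zero this
        rw [hm]; rfl
      simp [rowLen_eq_zero_of_numParts_le lam hk, h0]

end Creation

/-! ### The `q`-shifts acting on the alphabet `X^{tq}` -/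

namespace Creation

open Finset in
/-- The operator `creation`, in terms of the coefficients `creationTerm`. -/
theorem creation_eq_sum_creationTerm (n k : ℕ) (f : RatFun n) :
    creation n k f = ∑ I ∈ (univ : Finset (Fin n)).powersetCard k, ∑ J ∈ I.powerset,
      creationTerm (tv n) xv 1 univ I J * shift J f := by
  have hres : ∀ (c d : RatFun n) (I J : Finset (Fin n)),
      resultant c I d J / resultant 1 I 1 J = crossRatio c d xv I J := by
    intro c d I J
    simp only [resultant, crossRatio, ← prod_div_distrib, one_mul]
  refine sum_congr rfl fun I hI => ?_
  rw [sum_powerset, (mem_powersetCard.mp hI).2]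
  refine sum_congr rfl fun l _ => ?_
  rw [macdonald, mul_sum, mul_sum]
  refine sum_congr rfl fun J hJ => ?_
  rw [hres, hres, creationTerm, (mem_powersetCard.mp hJ).2, compl_eq_univ_sdiff]
  simp only [Pi.one_apply, prod_const_one]
  ring

theorem var_injective (n : ℕ) : Function.Injective (var : Var n → RatFun n) :=
  (IsFractionRing.injective (MvPolynomial (Var n) ℝ) (RatFun n)).comp MvPolynomial.X_injective

theorem var_ne_zero {n : ℕ} (v : Var n) : (var v : RatFun n) ≠ 0 := fun h =>
  MvPolynomial.X_ne_zero v (IsFractionRing.injective (MvPolynomial (Var n) ℝ) (RatFun n)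
    (h.trans (map_zero _).symm))

theorem var_pow_sub_one_ne_zero {n : ℕ} (v : Var n) (i : ℕ+) :
    (var v : RatFun n) ^ (i : ℕ) - 1 ≠ 0 := by
  intro h
  have h1 : (MvPolynomial.X v : MvPolynomial (Var n) ℝ) ^ (i : ℕ) = 1 := by
    apply IsFractionRing.injective (MvPolynomial (Var n) ℝ) (RatFun n)
    rw [map_pow, map_one]
    exact sub_eq_zero.mp h
  have h2 := congrArg (MvPolynomial.eval 0) h1
  simp [i.ne_zero] at h2

theorem adams_var {n : ℕ} (i : ℕ+) (v : Var n) : adams n i (var v) = var v ^ (i : ℕ) := by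
  rw [adams, var, IsFractionRing.lift_algebraMap, ← map_pow]
  exact congrArg (algebraMap (MvPolynomial (Var n) ℝ) (RatFun n))
    (MvPolynomial.expand_X (R := ℝ) (i : ℕ) v)

theorem adams_alphabetTQ (n : ℕ) (i : ℕ+) : adams n i (alphabetTQ n) =
    (∑ j : Fin n, xv j ^ (i : ℕ)) * (tv n ^ (i : ℕ) - 1) / (qv n ^ (i : ℕ) - 1) := by
  simp only [alphabetTQ, alphabet, map_div₀, map_mul, map_sub, map_sum, map_one, adams_var]

/-- The shift changes `x_j^i` by `(q^i - 1) x_j^i`, which cancels the denominator of `Ψ_i[X^{tq}]`;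
hence `Θ_J` exchanges variables `x_j` for `t x_j`, free of `q`. -/
theorem shift_adams_alphabetTQ {n : ℕ} (J : Finset (Fin n)) (i : ℕ+) :
    shift J (adams n i (alphabetTQ n)) = adams n i (alphabetTQ n) +
      ∑ j ∈ J, ((tv n * xv j) ^ (i : ℕ) - xv j ^ (i : ℕ)) := by
  have hq := var_pow_sub_one_ne_zero (n := n) Var.q i
  have hsum : shift J (∑ j : Fin n, xv j ^ (i : ℕ)) = ∑ j : Fin n, (xv j : RatFun n) ^ (i : ℕ) +
      (qv n ^ (i : ℕ) - 1) * ∑ j ∈ J, xv j ^ (i : ℕ) := by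
    rw [map_sum, ← Finset.sum_add_sum_compl J, ← Finset.sum_add_sum_compl J fun j => xv j ^ (i : ℕ),
      Finset.sum_congr rfl fun j (hj : j ∈ J) => show shift J (xv j ^ (i : ℕ)) =
        qv n ^ (i : ℕ) * xv j ^ (i : ℕ) by
          rw [map_pow, shift_var]; simp [shiftVar, hj, var, mul_pow],
      Finset.sum_congr rfl fun j (hj : j ∈ Jᶜ) => show shift J (xv j ^ (i : ℕ)) =
        xv j ^ (i : ℕ) by
          rw [map_pow, shift_var]; simp [shiftVar, Finset.mem_compl.mp hj, var],
      ← Finset.mul_sum]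
    ring
  have ht : shift J (tv n) = tv n := shift_var J _
  have hq' : shift J (qv n) = qv n := shift_var J _
  have hd : ∑ j ∈ J, ((tv n * xv j) ^ (i : ℕ) - xv j ^ (i : ℕ)) =
      (tv n ^ (i : ℕ) - 1) * ∑ j ∈ J, xv j ^ (i : ℕ) := by
    rw [Finset.mul_sum]
    exact Finset.sum_congr rfl fun j _ => by ring
  rw [adams_alphabetTQ, map_div₀, map_mul, hsum, map_sub, map_sub, map_pow, map_pow, map_one, ht,
    hq', hd]
  field_simp

/-- Multiplying the alphabet by `q` has the same effect as shifting all the variables; this absorbs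
the powers of `q` in the final determinant. -/
theorem qv_pow_mul_adams_alphabetTQ (n : ℕ) (i : ℕ+) :
    qv n ^ (i : ℕ) * adams n i (alphabetTQ n) = adams n i (alphabetTQ n) +
      ∑ j : Fin n, ((tv n * xv j) ^ (i : ℕ) - xv j ^ (i : ℕ)) := by
  have hq := var_pow_sub_one_ne_zero (n := n) Var.q i
  have hd : ∑ j : Fin n, ((tv n * xv j) ^ (i : ℕ) - xv j ^ (i : ℕ)) =
      (tv n ^ (i : ℕ) - 1) * ∑ j : Fin n, xv j ^ (i : ℕ) := by
    rw [Finset.mul_sum]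
    exact Finset.sum_congr rfl fun j _ => by ring
  rw [adams_alphabetTQ, hd]
  field_simp
  ring

theorem shift_algebraMap_real {n : ℕ} (J : Finset (Fin n)) (r : ℝ) :
    shift J (algebraMap ℝ (RatFun n) r) = algebraMap ℝ (RatFun n) r := by
  rw [IsScalarTower.algebraMap_apply ℝ (MvPolynomial (Var n) ℝ) (RatFun n), shift,
    IsFractionRing.lift_algebraMap]
  simp [MvPolynomial.algebraMap_eq]

theorem shift_aeval {n : ℕ} (J : Finset (Fin n)) (p : ℕ+ → RatFun n) (f : SymFun) :
    shift J (MvPolynomial.aeval p f) = MvPolynomial.aeval (fun i => shift J (p i)) f := by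
  rw [MvPolynomial.map_aeval, MvPolynomial.aeval_def]
  have : (shift J).comp (algebraMap ℝ (RatFun n)) = algebraMap ℝ (RatFun n) :=
    RingHom.ext (shift_algebraMap_real J)
  rw [this]
  rfl

/-! ### Coefficient extraction as a linear functional -/

section

open Polynomial

variable {K ι : Type*} [Field K] [DecidableEq ι] [Fintype ι]

/-- The linear functional `p ↦ [y^M] (p G / D)` on polynomials, where
`D = ∏_i (1 - t x_i y)`. -/
noncomputable def coeffFunctional (t : K) (x : ι → K) (G : PowerSeries K) (M : ℕ) :
    K[X] →ₗ[K] K where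
  toFun p := PowerSeries.coeff M ((p : PowerSeries K) * (G *
    ((shiftPoly t x Finset.univ ∅ : K[X]) : PowerSeries K)⁻¹))
  map_add' p r := by rw [Polynomial.coe_add, add_mul, map_add]
  map_smul' c p := by
    rw [Polynomial.smul_eq_C_mul, Polynomial.coe_mul, Polynomial.coe_C, mul_assoc,
      PowerSeries.coeff_C_mul, RingHom.id_apply, smul_eq_mul]

/-- Since `D` is `shiftPoly` for `J = ∅`, the quotient `shiftPoly t x univ J / D` is `∏_{j ∈ J} (1 -
x_j y) / (1 - t x_j y)`, exactly the factor by which exchanging `x_j` for `t x_j` multiplies the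
generating series. -/
theorem coeffFunctional_X_pow_mul_shiftPoly [Algebra ℝ K] [CharZero K] (t : K) (x : ι → K)
    (p : ℕ+ → K) (J : Finset ι) (e M : ℕ) (m : ℤ) (hm : m + e = M) :
    coeffFunctional t x (completeSeries p) M (X ^ e * shiftPoly t x Finset.univ J) =
      MvPolynomial.aeval (fun i : ℕ+ => p i + ∑ j ∈ J, ((t * x j) ^ (i : ℕ) - x j ^ (i : ℕ)))
        (completeZ m) := by
  rw [← coeff_X_pow_mul_completeSeries _ e M m hm]
  have hex := completeSeries_exchange_mul p (fun j => t * x j) x J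
  set G := completeSeries p
  set G' := completeSeries fun i : ℕ+ => p i + ∑ j ∈ J, ((t * x j) ^ (i : ℕ) - x j ^ (i : ℕ))
  have hcoe : ∀ A : Finset ι, ((shiftPoly t x Finset.univ A : K[X]) : PowerSeries K) =
      (∏ j ∈ A, (1 - PowerSeries.C (x j) * PowerSeries.X)) *
        ∏ j ∈ Finset.univ \ A, (1 - PowerSeries.C (t * x j) * PowerSeries.X) := by
    intro A
    change Polynomial.coeToPowerSeries.ringHom (shiftPoly t x Finset.univ A) = _
    simp only [shiftPoly, map_mul, map_prod, map_sub, map_one,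
      Polynomial.coeToPowerSeries.ringHom_apply, Polynomial.coe_C, Polynomial.coe_X]
  set D : PowerSeries K := ((shiftPoly t x Finset.univ ∅ : K[X]) : PowerSeries K) with hD
  have hD' : D = (∏ j ∈ J, (1 - PowerSeries.C (t * x j) * PowerSeries.X)) *
      ∏ j ∈ Finset.univ \ J, (1 - PowerSeries.C (t * x j) * PowerSeries.X) := by
    rw [hD, hcoe, Finset.prod_empty, one_mul, Finset.sdiff_empty, mul_comm,
      Finset.prod_sdiff (Finset.subset_univ J)]
  have hD0 : PowerSeries.constantCoeff D ≠ 0 := by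
    rw [hD, hcoe]
    simp [map_prod]
  have key : ((shiftPoly t x Finset.univ J : K[X]) : PowerSeries K) * (G * D⁻¹) = G' := by
    calc _ = (G * ∏ j ∈ J, (1 - PowerSeries.C (x j) * PowerSeries.X)) *
          (∏ j ∈ Finset.univ \ J, (1 - PowerSeries.C (t * x j) * PowerSeries.X)) * D⁻¹ := by
          rw [hcoe]; ring
      _ = G' * (D * D⁻¹) := by rw [← hex, hD']; ring
      _ = G' := by rw [PowerSeries.mul_inv_cancel D hD0, mul_one]
  change PowerSeries.coeff M (((X ^ e * shiftPoly t x Finset.univ J : K[X]) : PowerSeries K) *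
    (G * D⁻¹)) = _
  rw [Polynomial.coe_mul, mul_assoc, key, Polynomial.coe_pow, Polynomial.coe_X]

end

end Creation

theorem corollary4p3 (n k : ℕ) (lam : YoungDiagram) (hlam : Creation.numParts lam ≤ k) :
    Creation.creation n k (Creation.pleth (Creation.schur lam) (Creation.alphabetTQ n)) =
      Matrix.det (Matrix.of fun i j : Fin k =>
        (1 - Creation.qv n ^ Creation.fIdx lam i j * Creation.tv n ^ (k - ((j : ℕ) + 1))) *
          Creation.pleth (Creation.completeZ (Creation.fIdx lam i j))
            (Creation.alphabetTQ n)) := by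
  open Creation in
  set p : ℕ+ → RatFun n := fun i => adams n i (alphabetTQ n) with hp
  have hx : Function.Injective (xv : Fin n → RatFun n) := fun i j h =>
    Var.x.inj (var_injective n h)
  -- With rows and columns numbered from `0`, extracting degree `λ_a + k - a` turns `X^{k-j}` on the
  -- left into the index `λ_a + j - a` of the Jacobi-Trudi determinant and `X^{k-(j+1)}` on the
  -- right into `f(a, j)`.
  have hlin := sum_creationTerm_mul_det_linearMap (k := k) (tv n) (var_ne_zero _) xv Finset.univ
    hx.injOn (fun i _ => var_ne_zero _)
    fun a => coeffFunctional (tv n) xv (completeSeries p) (lam.rowLen a + (k - a))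
  rw [creation_eq_sum_creationTerm]
  refine Eq.trans ?_ (hlin.trans ?_)
  · refine Finset.sum_congr rfl fun I _ => Finset.sum_congr rfl fun J _ => ?_
    congr 1
    rw [pleth, schur_eq_det lam hlam, shift_aeval, AlgHom.map_det]
    congr 1
    ext a j
    rw [Matrix.of_apply, coeffFunctional_X_pow_mul_shiftPoly _ _ _ _ _ _
      ((lam.rowLen a : ℤ) + (j : ℤ) - (a : ℤ)) (by omega)]
    simp only [hp, ← shift_adams_alphabetTQ]
    rfl
  · congr 1
    ext a j
    have hm : fIdx lam a j + (k - ((j : ℕ) + 1) : ℕ) = (lam.rowLen a + (k - a) : ℕ) := by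
      simp only [fIdx]
      omega
    rw [Matrix.of_apply, Matrix.of_apply, mul_sub, mul_left_comm, ← Polynomial.smul_eq_C_mul,
      map_sub, map_smul, coeffFunctional_X_pow_mul_shiftPoly _ _ _ _ _ _ _ hm,
      coeffFunctional_X_pow_mul_shiftPoly _ _ _ _ _ _ _ hm]
    -- The polynomial `shiftPoly` for all variables produces the alphabet `q X^{tq}`, and
    -- homogeneity of `S_f` releases `q^f`.
    simp only [hp, ← qv_pow_mul_adams_alphabetTQ]
    rw [aeval_completeZ_scale]
    simp only [Finset.sum_empty, add_zero, smul_eq_mul, pleth]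
    ring
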